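/- Let $k$ be an algebraically closed field of characteristic $0$. For a finite group $G$, regard $k[G]$ as a Hopf algebra with $\Delta(g)=g\otimes g$, $\varepsilon(g)=1$, $S(g)=g^{-1}$ for $g\in G$. A twist for a Hopf algebra $(A,\Delta,\varepsilon,S)$ over $k$ is an invertible element $J\in A\otimes A$ such that $$(\Delta\otimes \mathrm{id})(J)(J\otimes 1)=(\mathrm{id}\otimes\Delta)(J)(1\otimes J),\qquad (\varepsilon\otimes \mathrm{id})(J)=(\mathrm{id}\otimes\varepsilon)(J)=1 .$$ For a twist $J$, $A^J$ denotes the Hopf algebra with the same algebra structure and counit as $A$, with coproduct $\Delta^J(x)=J^{-1}\Delta(x)J$ and antipode $S^J(x)=Q^{-1}S(x)Q$, where $Q=m(S\otimes\mathrm{id})(J)$ and $m$ is the multiplication of $A$. Write $J_{21}$ for the image of $J$ under the flip. When $A=k[G]$, the pair $(k[G]^J,J_{21}^{-1}J)$ is a triangular Hopf algebra, and $J$ is called a minimal twist for $k[G]$ if the linear map $(k[G]^J)^*\to k[G]^J$, $f\mapsto (f\otimes\mathrm{id})(J_{21}^{-1}J)$, is bijective. Twists $J,J'$ for $A$ are gauge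 equivalent if $J'=\Delta(x)J(x^{-1}\otimes x^{-1})$ for some invertible $x\in A$ with $\varepsilon(x)=1$. An isomorphism of triangular Hopf algebras $(A,R)\to(B,R')$ is an isomorphism of Hopf algebras $f:A\to B$ with $(f\otimes f)(R)=R'$. **Theorem.** Let $G,G'$ be finite groups, let $H\subseteq G$ and $H'\subseteq G'$ be subgroups, and let $J,J'$ be minimal twists for $k[H],k[H']$, respectively. View $J$ as a twist for $k[G]$ and $J'$ as a twist for $k[G']$ by means of the inclusions $k[H]\subseteq k[G]$ and $k[H']\subseteq k[G']$. If the triangular Hopf algebras $(k[G]^J,J_{21}^{-1}J)$ and $(k[G']^{J'},(J'_{21})^{-1}J')$ are isomorphic, then there exists a group isomorphism $\phi:G\to G'$ such that $\phi(H)=H'$ and $(\phi\otimes\phi)(J)$ is gauge equivalent to $J'$ as twists for $k[H']$. -/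

import Mathlib

open scoped TensorProduct

noncomputable section

namespace HopfTwist

section Legs

variable (k A : Type*) [CommRing k] [Ring A] [Bialgebra k A]

/-- `Δ ⊗ id : A ⊗ A → A ⊗ A ⊗ A`. -/
def comulLeft : A ⊗[k] A →ₐ[k] A ⊗[k] (A ⊗[k] A) :=
  (Algebra.TensorProduct.assoc k k k A A A).toAlgHom.comp
    (Algebra.TensorProduct.map (Bialgebra.comulAlgHom k A) (AlgHom.id k A))

/-- `id ⊗ Δ : A ⊗ A → A ⊗ A ⊗ A`. -/
def comulRight : A ⊗[k] A →ₐ[k] A ⊗[k] (A ⊗[k] A) :=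
  Algebra.TensorProduct.map (AlgHom.id k A) (Bialgebra.comulAlgHom k A)

/-- `X ↦ X₁₂`, i.e. `a ⊗ b ↦ a ⊗ b ⊗ 1`. -/
def leg12 : A ⊗[k] A →ₐ[k] A ⊗[k] (A ⊗[k] A) :=
  Algebra.TensorProduct.map (AlgHom.id k A) Algebra.TensorProduct.includeLeft

/-- `X ↦ X₁₃`, i.e. `a ⊗ b ↦ a ⊗ 1 ⊗ b`. -/
def leg13 : A ⊗[k] A →ₐ[k] A ⊗[k] (A ⊗[k] A) :=
  Algebra.TensorProduct.map (AlgHom.id k A) Algebra.TensorProduct.includeRight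

/-- `X ↦ X₂₃`, i.e. `a ⊗ b ↦ 1 ⊗ a ⊗ b`. -/
def leg23 : A ⊗[k] A →ₐ[k] A ⊗[k] (A ⊗[k] A) :=
  Algebra.TensorProduct.includeRight

/-- `ε ⊗ id : A ⊗ A → A`. -/
def counitLeft : A ⊗[k] A →ₐ[k] A :=
  (Algebra.TensorProduct.lid k A).toAlgHom.comp
    (Algebra.TensorProduct.map (Bialgebra.counitAlgHom k A) (AlgHom.id k A))

/-- `id ⊗ ε : A ⊗ A → A`. -/
def counitRight : A ⊗[k] A →ₐ[k] A :=
  (Algebra.TensorProduct.rid k k A).toAlgHom.comp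
    (Algebra.TensorProduct.map (AlgHom.id k A) (Bialgebra.counitAlgHom k A))

/-- The flip `X ↦ X₂₁`, i.e. `a ⊗ b ↦ b ⊗ a`. -/
def flip : A ⊗[k] A →ₐ[k] A ⊗[k] A :=
  (Algebra.TensorProduct.comm k A A).toAlgHom

variable {k A}

lemma comulLeft_tmul (a b : A) : comulLeft k A (a ⊗ₜ b) =
    Algebra.TensorProduct.assoc k k k A A A (Coalgebra.comul (R := k) a ⊗ₜ b) := rfl

lemma comulRight_tmul (a b : A) :
    comulRight k A (a ⊗ₜ b) = a ⊗ₜ Coalgebra.comul (R := k) b := rfl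

lemma leg12_tmul (a b : A) : leg12 k A (a ⊗ₜ b) = a ⊗ₜ (b ⊗ₜ 1) := rfl

lemma leg13_tmul (a b : A) : leg13 k A (a ⊗ₜ b) = a ⊗ₜ (1 ⊗ₜ b) := rfl

lemma leg23_apply (x : A ⊗[k] A) : leg23 k A x = 1 ⊗ₜ x := rfl

lemma counitLeft_tmul (a b : A) :
    counitLeft k A (a ⊗ₜ b) = Coalgebra.counit (R := k) a • b := rfl

lemma counitRight_tmul (a b : A) :
    counitRight k A (a ⊗ₜ b) = Coalgebra.counit (R := k) b • a := rfl

lemma flip_tmul (a b : A) : flip k A (a ⊗ₜ b) = b ⊗ₜ a := rfl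

end Legs

/-! ### Triangular Hopf algebras -/

section Triangular

variable {k A B : Type*} [CommRing k] [Ring A] [HopfAlgebra k A] [Ring B] [HopfAlgebra k B]

/-- `(A, R)` is a triangular Hopf algebra: `R` is invertible with `R⁻¹ = R₂₁`,
`(Δ ⊗ id)(R) = R₁₃ R₂₃`, `(id ⊗ Δ)(R) = R₁₃ R₁₂` and `Δᶜᵒᵖ(a) R = R Δ(a)` for all `a`. -/
structure IsTriangular (R : A ⊗[k] A) : Prop where
  mul_flip : R * flip k A R = 1
  flip_mul : flip k A R * R = 1
  comulLeft_eq : comulLeft k A R = leg13 k A R * leg23 k A R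
  comulRight_eq : comulRight k A R = leg13 k A R * leg12 k A R
  comul_flip (a : A) :
    flip k A (Coalgebra.comul (R := k) a) * R = R * Coalgebra.comul (R := k) a

/-- The linear map `A* → A`, `f ↦ (f ⊗ id)(R)`, attached to `R ∈ A ⊗ A`. -/
def dualMap (R : A ⊗[k] A) : Module.Dual k A →ₗ[k] A where
  toFun f := TensorProduct.lid k A (f.rTensor A R)
  map_add' f g := by simp [LinearMap.rTensor_add]
  map_smul' c f := by simp [LinearMap.rTensor_smul]

/-- `(A, R)` is minimal triangular: it is triangular and `R`, considered as a linear map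
`A* → A`, is an isomorphism. -/
structure IsMinimalTriangular (R : A ⊗[k] A) : Prop where
  isTriangular : IsTriangular R
  bijective : Function.Bijective (dualMap R)

/-- `(A, R)` and `(B, S)` are isomorphic as triangular Hopf algebras: there is an isomorphism of
Hopf algebras `f : A → B` (as usual, a bialgebra isomorphism; it automatically commutes with the
antipodes) such that `(f ⊗ f)(R) = S`. -/
def TriangularIso (R : A ⊗[k] A) (S : B ⊗[k] B) : Prop :=
  ∃ f : A ≃ₐc[k] B, TensorProduct.map (f : A →ₗ[k] B) (f : A →ₗ[k] B) R = S

end Triangular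

/-! ### Twists -/

/-- A twist for `A`: an invertible `J ∈ A ⊗ A` with
`(Δ ⊗ id)(J) (J ⊗ 1) = (id ⊗ Δ)(J) (1 ⊗ J)` and `(ε ⊗ id)(J) = (id ⊗ ε)(J) = 1`. -/
structure Twist (k A : Type*) [CommRing k] [Ring A] [HopfAlgebra k A] where
  elt : (A ⊗[k] A)ˣ
  cocycle : comulLeft k A elt * leg12 k A elt = comulRight k A elt * leg23 k A elt
  counit_left : counitLeft k A elt = 1
  counit_right : counitRight k A elt = 1

namespace Twist

section Basic

variable {k A : Type*} [CommRing k] [Ring A] [HopfAlgebra k A] (J : Twist k A)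

lemma map_inv_mul {C : Type*} [Ring C] [Algebra k C] (φ : A ⊗[k] A →ₐ[k] C) :
    φ (J.elt⁻¹ : (A ⊗[k] A)ˣ) * φ J.elt = 1 := by
  rw [← map_mul, Units.inv_mul, map_one]

lemma map_mul_inv {C : Type*} [Ring C] [Algebra k C] (φ : A ⊗[k] A →ₐ[k] C) :
    φ J.elt * φ (J.elt⁻¹ : (A ⊗[k] A)ˣ) = 1 := by
  rw [← map_mul, Units.mul_inv, map_one]

lemma counit_left_inv : counitLeft k A (J.elt⁻¹ : (A ⊗[k] A)ˣ) = 1 := by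
  have h : counitLeft k A ((J.elt⁻¹ : (A ⊗[k] A)ˣ) * J.elt) = 1 := by simp
  simpa only [map_mul, J.counit_left, mul_one] using h

lemma counit_right_inv : counitRight k A (J.elt⁻¹ : (A ⊗[k] A)ˣ) = 1 := by
  have h : counitRight k A ((J.elt⁻¹ : (A ⊗[k] A)ˣ) * J.elt) = 1 := by simp
  simpa only [map_mul, J.counit_right, mul_one] using h

/-- The twisted coproduct `Δᴶ(x) = J⁻¹ Δ(x) J`. -/
def comul : A →ₐ[k] A ⊗[k] A where
  toFun x := (J.elt⁻¹ : (A ⊗[k] A)ˣ) * Coalgebra.comul (R := k) x * J.elt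
  map_one' := by simp
  map_mul' x y := by simp [mul_assoc]
  map_zero' := by simp
  map_add' x y := by simp [mul_add, add_mul]
  commutes' r := by
    rw [Bialgebra.comul_algebraMap, ← Algebra.commutes, mul_assoc, Units.inv_mul, mul_one]

lemma comul_apply (x : A) : J.comul x =
    (J.elt⁻¹ : (A ⊗[k] A)ˣ) * Coalgebra.comul (R := k) x * J.elt := rfl

lemma assoc_map_comul (y : A ⊗[k] A) :
    Algebra.TensorProduct.assoc k k k A A A
      (Algebra.TensorProduct.map J.comul (AlgHom.id k A) y) =
    leg12 k A (J.elt⁻¹ : (A ⊗[k] A)ˣ) * comulLeft k A y * leg12 k A J.elt := by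
  have key (z : A ⊗[k] A) : leg12 k A z = Algebra.TensorProduct.assoc k k k A A A (z ⊗ₜ 1) := by
    induction z with
    | zero => simp
    | tmul a b => rfl
    | add x y hx hy => simp [hx, hy, TensorProduct.add_tmul]
  induction y with
  | zero => simp
  | tmul a b =>
    rw [key, key, comulLeft_tmul, ← map_mul, ← map_mul]
    simp [comul_apply]
  | add x y hx hy => simp only [map_add, hx, hy, mul_add, add_mul]

lemma map_id_comul (y : A ⊗[k] A) :
    Algebra.TensorProduct.map (AlgHom.id k A) J.comul y =
    leg23 k A (J.elt⁻¹ : (A ⊗[k] A)ˣ) * comulRight k A y * leg23 k A J.elt := by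
  induction y with
  | zero => simp
  | tmul a b => simp [leg23_apply, comulRight_tmul, comul_apply]
  | add x y hx hy => simp only [map_add, hx, hy, mul_add, add_mul]

lemma coassoc (x : A) :
    Algebra.TensorProduct.assoc k k k A A A
      (Algebra.TensorProduct.map J.comul (AlgHom.id k A) (J.comul x)) =
    Algebra.TensorProduct.map (AlgHom.id k A) J.comul (J.comul x) := by
  rw [assoc_map_comul, map_id_comul, comul_apply]
  have hΔ : comulLeft k A (Coalgebra.comul (R := k) x) =
      comulRight k A (Coalgebra.comul (R := k) x) := Coalgebra.coassoc_apply x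
  have hi : leg12 k A (J.elt⁻¹ : (A ⊗[k] A)ˣ) * comulLeft k A (J.elt⁻¹ : (A ⊗[k] A)ˣ) =
      leg23 k A (J.elt⁻¹ : (A ⊗[k] A)ˣ) * comulRight k A (J.elt⁻¹ : (A ⊗[k] A)ˣ) := by
    refine left_inv_eq_right_inv (a := comulLeft k A J.elt * leg12 k A J.elt) ?_ ?_
    · rw [mul_assoc, ← mul_assoc (comulLeft k A _), J.map_inv_mul, one_mul, J.map_inv_mul]
    · rw [J.cocycle, mul_assoc, ← mul_assoc (leg23 k A _), J.map_mul_inv, one_mul, J.map_mul_inv]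
  simp only [map_mul, hΔ, ← mul_assoc, hi]
  rw [mul_assoc _ (comulLeft k A J.elt), J.cocycle, ← mul_assoc]

lemma counitLeft_comul (x : A) : counitLeft k A (J.comul x) = x := by
  have h : counitLeft k A (Coalgebra.comul (R := k) x) = x := by
    have := congrArg (TensorProduct.lid k A) (Coalgebra.rTensor_counit_comul (R := k) x)
    rw [TensorProduct.lid_tmul, one_smul] at this
    exact this
  rw [comul_apply, map_mul, map_mul, J.counit_left, J.counit_left_inv, h, one_mul, mul_one]

lemma counitRight_comul (x : A) : counitRight k A (J.comul x) = x := by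
  have h : counitRight k A (Coalgebra.comul (R := k) x) = x := by
    have := congrArg (TensorProduct.rid k A) (Coalgebra.lTensor_counit_comul (R := k) x)
    rw [TensorProduct.rid_tmul, one_smul] at this
    exact this
  rw [comul_apply, map_mul, map_mul, J.counit_right, J.counit_right_inv, h, one_mul, mul_one]

/-! The antipode of the twisted Hopf algebra. -/

/-- `a ⊗ b ↦ S(a) c b`. -/
def sandwichLeft (c : A) : A ⊗[k] A →ₗ[k] A :=
  LinearMap.mul' k A ∘ₗ
    TensorProduct.map (LinearMap.mulRight k c ∘ₗ HopfAlgebra.antipode k) LinearMap.id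

/-- `a ⊗ b ↦ a c S(b)`. -/
def sandwichRight (c : A) : A ⊗[k] A →ₗ[k] A :=
  LinearMap.mul' k A ∘ₗ
    TensorProduct.map (LinearMap.mulRight k c) (HopfAlgebra.antipode k)

lemma sandwichLeft_tmul (c a b : A) :
    sandwichLeft (k := k) c (a ⊗ₜ b) = HopfAlgebra.antipode k a * c * b := rfl

lemma sandwichRight_tmul (c a b : A) :
    sandwichRight (k := k) c (a ⊗ₜ b) = a * c * HopfAlgebra.antipode k b := rfl

lemma sandwichLeft_mul (c : A) (y z : A ⊗[k] A) :
    sandwichLeft c (z * y) = sandwichLeft (sandwichLeft c z) y := by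
  induction y with
  | zero => simp
  | add y₁ y₂ h₁ h₂ => simp only [mul_add, map_add, h₁, h₂]
  | tmul a b =>
    induction z with
    | zero => simp [sandwichLeft_tmul]
    | add z₁ z₂ h₁ h₂ =>
      simp only [add_mul, map_add, h₁, h₂]
      simp only [sandwichLeft_tmul, add_mul, mul_add]
    | tmul u v =>
      simp only [Algebra.TensorProduct.tmul_mul_tmul, sandwichLeft_tmul,
        HopfAlgebra.antipode_mul_antidistrib, mul_assoc]

lemma sandwichRight_mul (c : A) (y z : A ⊗[k] A) :
    sandwichRight c (y * z) = sandwichRight (sandwichRight c z) y := by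
  induction y with
  | zero => simp
  | add y₁ y₂ h₁ h₂ => simp only [add_mul, map_add, h₁, h₂]
  | tmul a b =>
    induction z with
    | zero => simp [sandwichRight_tmul]
    | add z₁ z₂ h₁ h₂ =>
      simp only [mul_add, map_add, h₁, h₂]
      simp only [sandwichRight_tmul, add_mul, mul_add]
    | tmul u v =>
      simp only [Algebra.TensorProduct.tmul_mul_tmul, sandwichRight_tmul,
        HopfAlgebra.antipode_mul_antidistrib, mul_assoc]

lemma sandwichLeft_one_eq (y : A ⊗[k] A) : sandwichLeft 1 y =
    LinearMap.mul' k A ((HopfAlgebra.antipode k).rTensor A y) := by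
  induction y with
  | zero => simp
  | add y₁ y₂ h₁ h₂ => simp only [map_add, h₁, h₂]
  | tmul a b => simp [sandwichLeft_tmul]

lemma sandwichRight_one_eq (y : A ⊗[k] A) : sandwichRight 1 y =
    LinearMap.mul' k A ((HopfAlgebra.antipode k).lTensor A y) := by
  induction y with
  | zero => simp
  | add y₁ y₂ h₁ h₂ => simp only [map_add, h₁, h₂]
  | tmul a b => simp [sandwichRight_tmul]

lemma sandwichLeft_comul (x : A) : sandwichLeft 1 (Coalgebra.comul (R := k) x) =
    algebraMap k A (Coalgebra.counit x) := by
  rw [sandwichLeft_one_eq, HopfAlgebra.mul_antipode_rTensor_comul_apply]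

lemma sandwichRight_comul (x : A) : sandwichRight 1 (Coalgebra.comul (R := k) x) =
    algebraMap k A (Coalgebra.counit x) := by
  rw [sandwichRight_one_eq, HopfAlgebra.mul_antipode_lTensor_comul_apply]

/-- The element `Q = m ((S ⊗ id)(J))`. -/
def Q : A := LinearMap.mul' k A ((HopfAlgebra.antipode k).rTensor A J.elt)

/-- The element `m ((id ⊗ S)(J⁻¹))`, which is the inverse of `Q`. -/
def Qinv : A :=
  LinearMap.mul' k A ((HopfAlgebra.antipode k).lTensor A (J.elt⁻¹ : (A ⊗[k] A)ˣ))

lemma Q_eq : J.Q = sandwichLeft 1 (J.elt : A ⊗[k] A) := (sandwichLeft_one_eq _).symm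

lemma Qinv_eq : J.Qinv = sandwichRight 1 ((J.elt⁻¹ : (A ⊗[k] A)ˣ) : A ⊗[k] A) :=
  (sandwichRight_one_eq _).symm

/-- `a ⊗ b ⊗ c ↦ S(a) b S(c)`. -/
def tripleSS : A ⊗[k] (A ⊗[k] A) →ₗ[k] A :=
  LinearMap.mul' k A ∘ₗ TensorProduct.map (HopfAlgebra.antipode k) (sandwichRight 1)

/-- `a ⊗ b ⊗ c ↦ a S(b) c`. -/
def tripleS : A ⊗[k] (A ⊗[k] A) →ₗ[k] A :=
  LinearMap.mul' k A ∘ₗ TensorProduct.map LinearMap.id (sandwichLeft 1)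

lemma tripleSS_tmul (a : A) (y : A ⊗[k] A) :
    tripleSS (a ⊗ₜ y) = HopfAlgebra.antipode k a * sandwichRight 1 y := rfl

lemma tripleS_tmul (a : A) (y : A ⊗[k] A) : tripleS (a ⊗ₜ y) = a * sandwichLeft 1 y := rfl

lemma tripleSS_leg (z y : A ⊗[k] A) :
    tripleSS (leg12 k A z * leg23 k A y) = sandwichLeft 1 z * sandwichRight 1 y := by
  induction z with
  | zero => simp
  | add z₁ z₂ h₁ h₂ => simp only [map_add, add_mul, h₁, h₂]
  | tmul a b =>
    induction y with
    | zero => simp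
    | add y₁ y₂ h₁ h₂ => simp only [map_add, mul_add, h₁, h₂]
    | tmul u v =>
      simp [leg12_tmul, leg23_apply, tripleSS_tmul, sandwichLeft_tmul, sandwichRight_tmul,
        mul_assoc]

lemma tripleS_leg (z y : A ⊗[k] A) :
    tripleS (leg23 k A z * leg12 k A y) = sandwichRight 1 y * sandwichLeft 1 z := by
  induction z with
  | zero => simp
  | add z₁ z₂ h₁ h₂ => simp only [map_add, add_mul, mul_add, h₁, h₂]
  | tmul a b =>
    induction y with
    | zero => simp
    | add y₁ y₂ h₁ h₂ => simp only [map_add, mul_add, add_mul, h₁, h₂]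
    | tmul u v =>
      simp [leg12_tmul, leg23_apply, tripleS_tmul, sandwichLeft_tmul, sandwichRight_tmul,
        mul_assoc, HopfAlgebra.antipode_mul_antidistrib]

lemma tripleSS_assoc (y z : A ⊗[k] A) (a d : A) :
    tripleSS (Algebra.TensorProduct.assoc k k k A A A (y ⊗ₜ d) * a ⊗ₜ z) =
      HopfAlgebra.antipode k a * sandwichLeft 1 y * sandwichRight 1 z *
        HopfAlgebra.antipode k d := by
  induction y with
  | zero => simp
  | add y₁ y₂ h₁ h₂ => simp only [TensorProduct.add_tmul, map_add, add_mul, mul_add, h₁, h₂]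
  | tmul u v =>
    induction z with
    | zero => simp
    | add z₁ z₂ h₁ h₂ => simp only [TensorProduct.tmul_add, map_add, add_mul, mul_add, h₁, h₂]
    | tmul w x =>
      simp [tripleSS_tmul, sandwichLeft_tmul, sandwichRight_tmul,
        mul_assoc, HopfAlgebra.antipode_mul_antidistrib]

lemma tripleS_assoc (y z : A ⊗[k] A) (b c : A) :
    tripleS (c ⊗ₜ y * Algebra.TensorProduct.assoc k k k A A A (z ⊗ₜ b)) =
      c * sandwichRight 1 z * sandwichLeft 1 y * b := by
  induction y with
  | zero => simp
  | add y₁ y₂ h₁ h₂ => simp only [TensorProduct.tmul_add, map_add, add_mul, mul_add, h₁, h₂]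
  | tmul u v =>
    induction z with
    | zero => simp
    | add z₁ z₂ h₁ h₂ => simp only [TensorProduct.add_tmul, map_add, add_mul, mul_add, h₁, h₂]
    | tmul w x =>
      simp [tripleS_tmul, sandwichLeft_tmul, sandwichRight_tmul,
        mul_assoc, HopfAlgebra.antipode_mul_antidistrib]

lemma tripleSS_comul (p q : A ⊗[k] A) :
    tripleSS (comulLeft k A p * comulRight k A q) =
      HopfAlgebra.antipode k (counitLeft k A p * counitRight k A q) := by
  induction p with
  | zero => simp
  | add p₁ p₂ h₁ h₂ => simp only [map_add, add_mul, h₁, h₂]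
  | tmul c d =>
    induction q with
    | zero => simp
    | add q₁ q₂ h₁ h₂ => simp only [map_add, mul_add, h₁, h₂]
    | tmul a b =>
      rw [comulLeft_tmul, comulRight_tmul, tripleSS_assoc, sandwichLeft_comul,
        sandwichRight_comul, counitLeft_tmul, counitRight_tmul]
      simp [HopfAlgebra.antipode_mul_antidistrib, Algebra.algebraMap_eq_smul_one, smul_smul]

lemma tripleS_comul (p q : A ⊗[k] A) :
    tripleS (comulRight k A p * comulLeft k A q) =
      counitRight k A p * counitLeft k A q := by
  induction p with
  | zero => simp
  | add p₁ p₂ h₁ h₂ => simp only [map_add, add_mul, h₁, h₂]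
  | tmul c d =>
    induction q with
    | zero => simp
    | add q₁ q₂ h₁ h₂ => simp only [map_add, mul_add, h₁, h₂]
    | tmul a b =>
      rw [comulLeft_tmul, comulRight_tmul, tripleS_assoc, sandwichLeft_comul,
        sandwichRight_comul, counitLeft_tmul, counitRight_tmul]
      simp [Algebra.algebraMap_eq_smul_one, smul_smul, mul_comm]

lemma Q_mul_Qinv : J.Q * J.Qinv = 1 := by
  have h : leg12 k A J.elt * leg23 k A (J.elt⁻¹ : (A ⊗[k] A)ˣ) =
      comulLeft k A (J.elt⁻¹ : (A ⊗[k] A)ˣ) * comulRight k A J.elt := by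
    have := congrArg (fun t => comulLeft k A (J.elt⁻¹ : (A ⊗[k] A)ˣ) * t *
      leg23 k A (J.elt⁻¹ : (A ⊗[k] A)ˣ)) J.cocycle
    simpa only [← mul_assoc, J.map_inv_mul, one_mul, mul_assoc _ (leg23 k A J.elt),
      J.map_mul_inv, mul_one] using this
  rw [Q_eq, Qinv_eq, ← tripleSS_leg, h, tripleSS_comul, J.counit_left_inv, J.counit_right,
    mul_one, HopfAlgebra.antipode_one]

lemma Qinv_mul_Q : J.Qinv * J.Q = 1 := by
  have h : leg23 k A J.elt * leg12 k A (J.elt⁻¹ : (A ⊗[k] A)ˣ) =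
      comulRight k A (J.elt⁻¹ : (A ⊗[k] A)ˣ) * comulLeft k A J.elt := by
    have := congrArg (fun t => comulRight k A (J.elt⁻¹ : (A ⊗[k] A)ˣ) * t *
      leg12 k A (J.elt⁻¹ : (A ⊗[k] A)ˣ)) J.cocycle
    simpa only [← mul_assoc, J.map_inv_mul, one_mul, mul_assoc _ (leg12 k A J.elt),
      J.map_mul_inv, mul_one] using this.symm
  rw [Q_eq, Qinv_eq, ← tripleS_leg, h, tripleS_comul, J.counit_right_inv, J.counit_left, mul_one]

/-- The twisted antipode `Sᴶ(x) = Q⁻¹ S(x) Q`. -/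
def antipode : A →ₗ[k] A :=
  LinearMap.mulLeft k J.Qinv ∘ₗ LinearMap.mulRight k J.Q ∘ₗ HopfAlgebra.antipode k

lemma antipode_apply (x : A) : J.antipode x = J.Qinv * (HopfAlgebra.antipode k x * J.Q) := rfl

lemma mul_antipode_rTensor (x : A) :
    LinearMap.mul' k A (J.antipode.rTensor A (J.comul x)) =
      algebraMap k A (Coalgebra.counit x) := by
  have h (y : A ⊗[k] A) : LinearMap.mul' k A (J.antipode.rTensor A y) =
      J.Qinv * sandwichLeft J.Q y := by
    induction y with
    | zero => simp
    | add y₁ y₂ h₁ h₂ => simp only [map_add, mul_add, h₁, h₂]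
    | tmul a b => simp [antipode_apply, sandwichLeft_tmul, mul_assoc]
  have h' (c : k) (y : A ⊗[k] A) : sandwichLeft (algebraMap k A c) y = c • sandwichLeft 1 y := by
    induction y with
    | zero => simp
    | add y₁ y₂ h₁ h₂ => simp only [map_add, smul_add, h₁, h₂]
    | tmul a b => simp [sandwichLeft_tmul, Algebra.algebraMap_eq_smul_one]
  rw [h, J.Q_eq, ← sandwichLeft_mul, comul_apply, mul_assoc, Units.mul_inv_cancel_left,
    sandwichLeft_mul, sandwichLeft_comul, h', ← J.Q_eq, mul_smul_comm, Qinv_mul_Q,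
    Algebra.algebraMap_eq_smul_one]

lemma mul_antipode_lTensor (x : A) :
    LinearMap.mul' k A (J.antipode.lTensor A (J.comul x)) =
      algebraMap k A (Coalgebra.counit x) := by
  have h (y : A ⊗[k] A) : LinearMap.mul' k A (J.antipode.lTensor A y) =
      sandwichRight J.Qinv y * J.Q := by
    induction y with
    | zero => simp
    | add y₁ y₂ h₁ h₂ => simp only [map_add, add_mul, h₁, h₂]
    | tmul a b => simp [antipode_apply, sandwichRight_tmul, mul_assoc]
  have h' (c : k) (y : A ⊗[k] A) :
      sandwichRight (algebraMap k A c) y = c • sandwichRight 1 y := by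
    induction y with
    | zero => simp
    | add y₁ y₂ h₁ h₂ => simp only [map_add, smul_add, h₁, h₂]
    | tmul a b => simp [sandwichRight_tmul, Algebra.algebraMap_eq_smul_one]
  rw [h, J.Qinv_eq, ← sandwichRight_mul, comul_apply, Units.mul_inv_cancel_right,
    sandwichRight_mul, sandwichRight_comul, h', ← J.Qinv_eq, smul_mul_assoc, Qinv_mul_Q,
    Algebra.algebraMap_eq_smul_one]

end Basic

/-! ### The twisted Hopf algebra -/

section Twisted

variable {k A : Type*} [CommRing k] [Ring A] [HopfAlgebra k A]

/-- The underlying algebra of the twisted Hopf algebra `Aᴶ`, a copy of the algebra `A`. -/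
def Twisted (_J : Twist k A) : Type _ := A

variable (J : Twist k A)

instance : Ring J.Twisted := inferInstanceAs (Ring A)

/-- The bialgebra structure on the algebra `A` with coproduct `Δᴶ` and the counit of `A`. -/
abbrev bialgebra : Bialgebra k A :=
  Bialgebra.ofAlgHom J.comul (Bialgebra.counitAlgHom k A)
    (AlgHom.ext J.coassoc)
    (AlgHom.ext fun x => by
      apply (Algebra.TensorProduct.lid k A).injective
      exact (J.counitLeft_comul x).trans ((Algebra.TensorProduct.lid k A).apply_symm_apply x).symm)
    (AlgHom.ext fun x => by
      apply (Algebra.TensorProduct.rid k k A).injective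
      exact (J.counitRight_comul x).trans
        ((Algebra.TensorProduct.rid k k A).apply_symm_apply x).symm)

/-- The Hopf algebra structure on the algebra `A` with coproduct `Δᴶ`, the counit of `A` and
antipode `Sᴶ`. -/
abbrev hopfAlgebra : HopfAlgebra k A :=
  { J.bialgebra with
    antipode := J.antipode
    mul_antipode_rTensor_comul := LinearMap.ext J.mul_antipode_rTensor
    mul_antipode_lTensor_comul := LinearMap.ext J.mul_antipode_lTensor }

instance : HopfAlgebra k J.Twisted := J.hopfAlgebra

/-- The element `J₂₁⁻¹ J`. For cocommutative `A`, such as a group algebra with its triangular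
structure `1 ⊗ 1`, it is the universal `R`-matrix of `Aᴶ`. -/
def rMatrix : J.Twisted ⊗[k] J.Twisted :=
  (flip k A (J.elt⁻¹ : (A ⊗[k] A)ˣ) * J.elt : A ⊗[k] A)

/-! For cocommutative `A`, the pair `(Aᴶ, J₂₁⁻¹ J)` is triangular. -/

/-- `a ⊗ b ⊗ c ↦ b ⊗ c ⊗ a`. -/
def rotLeft : A ⊗[k] (A ⊗[k] A) →ₐ[k] A ⊗[k] (A ⊗[k] A) :=
  (Algebra.TensorProduct.assoc k k k A A A).toAlgHom.comp
    (Algebra.TensorProduct.comm k A (A ⊗[k] A)).toAlgHom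

/-- `a ⊗ b ⊗ c ↦ c ⊗ a ⊗ b`. -/
def rotRight : A ⊗[k] (A ⊗[k] A) →ₐ[k] A ⊗[k] (A ⊗[k] A) :=
  (Algebra.TensorProduct.comm k (A ⊗[k] A) A).toAlgHom.comp
    (Algebra.TensorProduct.assoc k k k A A A).symm.toAlgHom

/-- `a ⊗ b ⊗ c ↦ a ⊗ c ⊗ b`. -/
def swap23 : A ⊗[k] (A ⊗[k] A) →ₐ[k] A ⊗[k] (A ⊗[k] A) :=
  Algebra.TensorProduct.map (AlgHom.id k A) (flip k A)

/-- `a ⊗ b ⊗ c ↦ b ⊗ a ⊗ c`. -/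
def swap12 : A ⊗[k] (A ⊗[k] A) →ₐ[k] A ⊗[k] (A ⊗[k] A) :=
  (Algebra.TensorProduct.leftComm k A A A).toAlgHom

lemma rotLeft_tmul (a b c : A) :
    rotLeft (k := k) (a ⊗ₜ (b ⊗ₜ c)) = b ⊗ₜ (c ⊗ₜ a) := rfl

lemma rotRight_tmul (a b c : A) :
    rotRight (k := k) (a ⊗ₜ (b ⊗ₜ c)) = c ⊗ₜ (a ⊗ₜ b) := rfl

lemma swap23_tmul (a b c : A) :
    swap23 (k := k) (a ⊗ₜ (b ⊗ₜ c)) = a ⊗ₜ (c ⊗ₜ b) := rfl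

lemma swap12_tmul (a b c : A) :
    swap12 (k := k) (a ⊗ₜ (b ⊗ₜ c)) = b ⊗ₜ (a ⊗ₜ c) := rfl

lemma rotLeft_leg12 : (rotLeft (k := k)).comp (leg12 k A) = (leg13 k A).comp (flip k A) := by
  ext <;> rfl

lemma rotLeft_leg23 : (rotLeft (k := k)).comp (leg23 k A) = leg12 k A := by
  ext <;> rfl

lemma swap23_leg12 : (swap23 (k := k)).comp (leg12 k A) = leg13 k A := by
  ext <;> rfl

lemma swap23_leg23 : (swap23 (k := k)).comp (leg23 k A) = (leg23 k A).comp (flip k A) := by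
  ext <;> rfl

lemma rotRight_leg12 : (rotRight (k := k)).comp (leg12 k A) = leg23 k A := by
  ext <;> rfl

lemma rotRight_leg23 : (rotRight (k := k)).comp (leg23 k A) = (leg13 k A).comp (flip k A) := by
  ext <;> rfl

lemma swap12_leg12 : (swap12 (k := k)).comp (leg12 k A) = (leg12 k A).comp (flip k A) := by
  ext <;> rfl

lemma swap12_leg23 : (swap12 (k := k)).comp (leg23 k A) = leg13 k A := by
  ext <;> rfl

lemma rotLeft_comulRight :
    (rotLeft (k := k)).comp (comulRight k A) = (comulLeft k A).comp (flip k A) := by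
  ext <;> rfl

lemma rotRight_comulLeft :
    (rotRight (k := k)).comp (comulLeft k A) = (comulRight k A).comp (flip k A) := by
  have h (z : A ⊗[k] A) (b : A) :
      rotRight (k := k) (Algebra.TensorProduct.assoc k k k A A A (z ⊗ₜ b)) = b ⊗ₜ z := by
    induction z with
    | zero => simp
    | add z₁ z₂ h₁ h₂ => simp only [map_add, TensorProduct.add_tmul, TensorProduct.tmul_add, h₁, h₂]
    | tmul u v => rfl
  exact Algebra.TensorProduct.ext' fun a b => h _ b

lemma flip_flip (y : A ⊗[k] A) : flip k A (flip k A y) = y := by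
  induction y with
  | zero => simp
  | add z₁ z₂ h₁ h₂ => simp only [map_add, h₁, h₂]
  | tmul u v => rfl

section Cocommutative

variable [Coalgebra.IsCocomm k A]

lemma flip_comul (a : A) :
    flip k A (Coalgebra.comul (R := k) a) = Coalgebra.comul (R := k) a :=
  Coalgebra.comm_comul k a

lemma swap23_comulRight : (swap23 (k := k)).comp (comulRight k A) = comulRight k A :=
  Algebra.TensorProduct.ext' fun a b => by
    change a ⊗ₜ flip k A (Coalgebra.comul (R := k) b) = a ⊗ₜ Coalgebra.comul (R := k) b
    rw [flip_comul]

lemma swap12_comulLeft : (swap12 (k := k)).comp (comulLeft k A) = comulLeft k A := by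
  have h (z : A ⊗[k] A) (b : A) :
      swap12 (k := k) (Algebra.TensorProduct.assoc k k k A A A (z ⊗ₜ b)) =
        Algebra.TensorProduct.assoc k k k A A A (flip k A z ⊗ₜ b) := by
    induction z with
    | zero => simp
    | add z₁ z₂ h₁ h₂ => simp only [map_add, TensorProduct.add_tmul, h₁, h₂]
    | tmul u v => rfl
  refine Algebra.TensorProduct.ext' fun a b => (h (Coalgebra.comul (R := k) a) b).trans ?_
  rw [flip_comul, comulLeft_tmul]

lemma swap23_comulLeft :
    (swap23 (k := k)).comp (comulLeft k A) = (rotLeft (k := k)).comp (comulLeft k A) := by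
  have h (z : A ⊗[k] A) (b : A) :
      swap23 (k := k) (Algebra.TensorProduct.assoc k k k A A A (flip k A z ⊗ₜ b)) =
        rotLeft (k := k) (Algebra.TensorProduct.assoc k k k A A A (z ⊗ₜ b)) := by
    induction z with
    | zero => simp
    | add z₁ z₂ h₁ h₂ => simp only [map_add, TensorProduct.add_tmul, h₁, h₂]
    | tmul u v => rfl
  refine Algebra.TensorProduct.ext' fun a b => Eq.trans ?_ (h (Coalgebra.comul (R := k) a) b)
  rw [flip_comul, AlgHom.comp_apply, comulLeft_tmul]

lemma swap12_comulRight :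
    (swap12 (k := k)).comp (comulRight k A) = (rotRight (k := k)).comp (comulRight k A) := by
  have h (z : A ⊗[k] A) (a : A) :
      swap12 (k := k) (a ⊗ₜ flip k A z) = rotRight (k := k) (a ⊗ₜ z) := by
    induction z with
    | zero => simp
    | add z₁ z₂ h₁ h₂ => simp only [map_add, TensorProduct.tmul_add, h₁, h₂]
    | tmul u v => rfl
  refine Algebra.TensorProduct.ext' fun a b => Eq.trans ?_ (h (Coalgebra.comul (R := k) b) a)
  rw [flip_comul, AlgHom.comp_apply, comulRight_tmul]

lemma comulLeft_rMatrix :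
    leg12 k A (J.elt⁻¹ : (A ⊗[k] A)ˣ) *
        comulLeft k A (flip k A (J.elt⁻¹ : (A ⊗[k] A)ˣ) * J.elt) * leg12 k A J.elt =
      leg13 k A (flip k A (J.elt⁻¹ : (A ⊗[k] A)ˣ) * J.elt) *
        leg23 k A (flip k A (J.elt⁻¹ : (A ⊗[k] A)ˣ) * J.elt) := by
  have c1 := congrArg (rotLeft (k := k)) J.cocycle
  have c2 := congrArg (swap23 (k := k)) J.cocycle
  simp only [map_mul, ← AlgHom.comp_apply, rotLeft_leg12, rotLeft_leg23, rotLeft_comulRight,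
    swap23_leg12, swap23_leg23, swap23_comulRight, swap23_comulLeft] at c1 c2
  have hX := J.map_inv_mul ((rotLeft (k := k)).comp (comulLeft k A))
  have hX' := J.map_mul_inv ((rotLeft (k := k)).comp (comulLeft k A))
  have h13 := J.map_mul_inv ((leg13 k A).comp (flip k A))
  have h23 := J.map_mul_inv ((leg23 k A).comp (flip k A))
  have hcl := J.map_inv_mul ((comulLeft k A).comp (flip k A))
  have h12 := J.map_inv_mul (leg12 k A)
  have e1 : leg12 k A (J.elt⁻¹ : (A ⊗[k] A)ˣ) *
      (comulLeft k A).comp (flip k A) (J.elt⁻¹ : (A ⊗[k] A)ˣ) =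
      (leg13 k A).comp (flip k A) (J.elt⁻¹ : (A ⊗[k] A)ˣ) *
      (rotLeft (k := k)).comp (comulLeft k A) (J.elt⁻¹ : (A ⊗[k] A)ˣ) := by
    refine left_inv_eq_right_inv
      (a := (comulLeft k A).comp (flip k A) J.elt * leg12 k A J.elt) ?_ ?_
    · rw [mul_assoc, ← mul_assoc _ _ (leg12 k A _), hcl, one_mul, h12]
    · rw [← c1, mul_assoc, ← mul_assoc _ _ ((rotLeft (k := k)).comp _ _), h13, one_mul, hX']
  have e2 : (rotLeft (k := k)).comp (comulLeft k A) (J.elt⁻¹ : (A ⊗[k] A)ˣ) *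
      comulRight k A J.elt =
      leg13 k A J.elt * (leg23 k A).comp (flip k A) (J.elt⁻¹ : (A ⊗[k] A)ˣ) := by
    have := congrArg (fun t => (rotLeft (k := k)).comp (comulLeft k A) (J.elt⁻¹ : (A ⊗[k] A)ˣ) *
      t * (leg23 k A).comp (flip k A) (J.elt⁻¹ : (A ⊗[k] A)ˣ)) c2
    simpa only [← mul_assoc, hX, one_mul,
      mul_assoc _ ((leg23 k A).comp (flip k A) (J.elt : A ⊗[k] A)), h23, mul_one] using this.symm
  simp only [map_mul, ← AlgHom.comp_apply]
  rw [← mul_assoc, e1, mul_assoc _ (comulLeft k A _), J.cocycle, mul_assoc, ← mul_assoc _ _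
    (leg23 k A _), e2]
  simp only [mul_assoc]

lemma comulRight_rMatrix :
    leg23 k A (J.elt⁻¹ : (A ⊗[k] A)ˣ) *
        comulRight k A (flip k A (J.elt⁻¹ : (A ⊗[k] A)ˣ) * J.elt) * leg23 k A J.elt =
      leg13 k A (flip k A (J.elt⁻¹ : (A ⊗[k] A)ˣ) * J.elt) *
        leg12 k A (flip k A (J.elt⁻¹ : (A ⊗[k] A)ˣ) * J.elt) := by
  have c1 := congrArg (rotRight (k := k)) J.cocycle
  have c2 := congrArg (swap12 (k := k)) J.cocycle
  simp only [map_mul, ← AlgHom.comp_apply, rotRight_leg12, rotRight_leg23, rotRight_comulLeft,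
    swap12_leg12, swap12_leg23, swap12_comulRight, swap12_comulLeft] at c1 c2
  have hY := J.map_inv_mul ((rotRight (k := k)).comp (comulRight k A))
  have hY' := J.map_mul_inv ((rotRight (k := k)).comp (comulRight k A))
  have h13 := J.map_mul_inv ((leg13 k A).comp (flip k A))
  have h12 := J.map_mul_inv ((leg12 k A).comp (flip k A))
  have hcr := J.map_inv_mul ((comulRight k A).comp (flip k A))
  have h23 := J.map_inv_mul (leg23 k A)
  have e1 : leg23 k A (J.elt⁻¹ : (A ⊗[k] A)ˣ) *
      (comulRight k A).comp (flip k A) (J.elt⁻¹ : (A ⊗[k] A)ˣ) =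
      (leg13 k A).comp (flip k A) (J.elt⁻¹ : (A ⊗[k] A)ˣ) *
      (rotRight (k := k)).comp (comulRight k A) (J.elt⁻¹ : (A ⊗[k] A)ˣ) := by
    refine left_inv_eq_right_inv
      (a := (comulRight k A).comp (flip k A) J.elt * leg23 k A J.elt) ?_ ?_
    · rw [mul_assoc, ← mul_assoc _ _ (leg23 k A _), hcr, one_mul, h23]
    · rw [c1, mul_assoc, ← mul_assoc _ _ ((rotRight (k := k)).comp _ _), h13, one_mul, hY']
  have e2 : (rotRight (k := k)).comp (comulRight k A) (J.elt⁻¹ : (A ⊗[k] A)ˣ) *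
      comulLeft k A J.elt =
      leg13 k A J.elt * (leg12 k A).comp (flip k A) (J.elt⁻¹ : (A ⊗[k] A)ˣ) := by
    have := congrArg (fun t => (rotRight (k := k)).comp (comulRight k A) (J.elt⁻¹ : (A ⊗[k] A)ˣ) *
      t * (leg12 k A).comp (flip k A) (J.elt⁻¹ : (A ⊗[k] A)ˣ)) c2
    simpa only [← mul_assoc, hY, one_mul,
      mul_assoc _ ((leg12 k A).comp (flip k A) (J.elt : A ⊗[k] A)), h12, mul_one] using this
  simp only [map_mul, ← AlgHom.comp_apply]
  rw [← mul_assoc, e1, mul_assoc _ (comulRight k A _), ← J.cocycle, mul_assoc, ← mul_assoc _ _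
    (leg12 k A _), e2]
  simp only [mul_assoc]

lemma comul_flip_rMatrix (a : A) :
    flip k A (J.comul a) * (flip k A (J.elt⁻¹ : (A ⊗[k] A)ˣ) * J.elt) =
      flip k A (J.elt⁻¹ : (A ⊗[k] A)ˣ) * J.elt * J.comul a := by
  rw [comul_apply, map_mul, map_mul, flip_comul, mul_assoc, ← mul_assoc (flip k A J.elt),
    J.map_mul_inv, one_mul]
  simp only [mul_assoc, Units.mul_inv_cancel_left]

/-- For cocommutative `A`, the pair `(Aᴶ, J₂₁⁻¹ J)` is a triangular Hopf algebra. -/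
theorem isTriangular_rMatrix : IsTriangular J.rMatrix where
  mul_flip := by
    change flip k A (J.elt⁻¹ : (A ⊗[k] A)ˣ) * J.elt *
      flip k A (flip k A (J.elt⁻¹ : (A ⊗[k] A)ˣ) * J.elt) = 1
    rw [map_mul, flip_flip, mul_assoc, Units.mul_inv_cancel_left, J.map_inv_mul]
  flip_mul := by
    change flip k A (flip k A (J.elt⁻¹ : (A ⊗[k] A)ˣ) * J.elt) *
      (flip k A (J.elt⁻¹ : (A ⊗[k] A)ˣ) * J.elt) = 1
    rw [map_mul, flip_flip, mul_assoc, ← mul_assoc (flip k A _), J.map_mul_inv, one_mul,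
      Units.inv_mul]
  comulLeft_eq := (J.assoc_map_comul _).trans J.comulLeft_rMatrix
  comulRight_eq := (J.map_id_comul _).trans J.comulRight_rMatrix
  comul_flip := J.comul_flip_rMatrix

end Cocommutative

/-- For cocommutative `A`, `J` is a minimal twist if `(Aᴶ, J₂₁⁻¹ J)` is minimal triangular. -/
def IsMinimal : Prop := IsMinimalTriangular J.rMatrix

/-- Two twists `J`, `J'` for `A` are gauge equivalent if `J' = Δ(x) J (x⁻¹ ⊗ x⁻¹)` for some
invertible `x ∈ A` with `ε(x) = 1`. -/
def GaugeEquivalent (J J' : Twist k A) : Prop :=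
  ∃ x : Aˣ, Coalgebra.counit (R := k) (x : A) = 1 ∧
    (J'.elt : A ⊗[k] A) =
      Coalgebra.comul (R := k) (x : A) * J.elt *
        (((x⁻¹ : Aˣ) : A) ⊗ₜ[k] ((x⁻¹ : Aˣ) : A))

end Twisted

/-! ### Image of a twist under a Hopf algebra map -/

section Map

variable {k A B : Type*} [CommRing k] [Ring A] [HopfAlgebra k A] [Ring B] [HopfAlgebra k B]

/-- `f ⊗ f : A ⊗ A → B ⊗ B`. -/
def map₂ (f : A →ₐc[k] B) : A ⊗[k] A →ₐ[k] B ⊗[k] B :=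
  Algebra.TensorProduct.map (f : A →ₐ[k] B) (f : A →ₐ[k] B)

/-- `f ⊗ f ⊗ f`. -/
def map₃ (f : A →ₐc[k] B) : A ⊗[k] (A ⊗[k] A) →ₐ[k] B ⊗[k] (B ⊗[k] B) :=
  Algebra.TensorProduct.map (f : A →ₐ[k] B) (map₂ f)

lemma map₂_tmul (f : A →ₐc[k] B) (a b : A) : map₂ f (a ⊗ₜ b) = f a ⊗ₜ f b := rfl

lemma map₃_tmul (f : A →ₐc[k] B) (a : A) (y : A ⊗[k] A) :
    map₃ f (a ⊗ₜ y) = f a ⊗ₜ map₂ f y := rfl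

lemma map₂_comul (f : A →ₐc[k] B) (a : A) :
    map₂ f (Coalgebra.comul (R := k) a) = Coalgebra.comul (R := k) (f a) :=
  CoalgHomClass.map_comp_comul_apply f a

lemma comulRight_map (f : A →ₐc[k] B) (y : A ⊗[k] A) :
    comulRight k B (map₂ f y) = map₃ f (comulRight k A y) := by
  induction y with
  | zero => simp
  | add y₁ y₂ h₁ h₂ => simp only [map_add, h₁, h₂]
  | tmul a b => rw [map₂_tmul, comulRight_tmul, comulRight_tmul, map₃_tmul, map₂_comul]

lemma comulLeft_map (f : A →ₐc[k] B) (y : A ⊗[k] A) :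
    comulLeft k B (map₂ f y) = map₃ f (comulLeft k A y) := by
  have h (z : A ⊗[k] A) (b : A) : Algebra.TensorProduct.assoc k k k B B B (map₂ f z ⊗ₜ f b) =
      map₃ f (Algebra.TensorProduct.assoc k k k A A A (z ⊗ₜ b)) := by
    induction z with
    | zero => simp
    | add z₁ z₂ h₁ h₂ => simp only [map_add, TensorProduct.add_tmul, h₁, h₂]
    | tmul u v => rfl
  induction y with
  | zero => simp
  | add y₁ y₂ h₁ h₂ => simp only [map_add, h₁, h₂]
  | tmul a b => rw [map₂_tmul, comulLeft_tmul, comulLeft_tmul, ← h, map₂_comul]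

lemma leg12_map (f : A →ₐc[k] B) (y : A ⊗[k] A) :
    leg12 k B (map₂ f y) = map₃ f (leg12 k A y) := by
  induction y with
  | zero => simp
  | add y₁ y₂ h₁ h₂ => simp only [map_add, h₁, h₂]
  | tmul a b => simp [map₂_tmul, leg12_tmul, map₃_tmul]

lemma leg23_map (f : A →ₐc[k] B) (y : A ⊗[k] A) :
    leg23 k B (map₂ f y) = map₃ f (leg23 k A y) := by
  simp [leg23_apply, map₃_tmul]

lemma counitLeft_map (f : A →ₐc[k] B) (y : A ⊗[k] A) :
    counitLeft k B (map₂ f y) = f (counitLeft k A y) := by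
  induction y with
  | zero => simp
  | add y₁ y₂ h₁ h₂ => simp only [map_add, h₁, h₂]
  | tmul a b => simp [map₂_tmul, counitLeft_tmul]

lemma counitRight_map (f : A →ₐc[k] B) (y : A ⊗[k] A) :
    counitRight k B (map₂ f y) = f (counitRight k A y) := by
  induction y with
  | zero => simp
  | add y₁ y₂ h₁ h₂ => simp only [map_add, h₁, h₂]
  | tmul a b => simp [map₂_tmul, counitRight_tmul]

/-- The twist `(f ⊗ f)(J)` for `B`, where `J` is a twist for `A` and `f : A → B` is a homomorphism
of Hopf algebras. -/
def map (f : A →ₐc[k] B) (J : Twist k A) : Twist k B where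
  elt := Units.map (map₂ f : A ⊗[k] A →* B ⊗[k] B) J.elt
  cocycle := by
    have h := congrArg (map₃ f) J.cocycle
    rw [map_mul, map_mul, ← comulLeft_map, ← comulRight_map, ← leg12_map, ← leg23_map] at h
    exact h
  counit_left := by
    have h := congrArg f J.counit_left
    rw [← counitLeft_map, map_one] at h
    exact h
  counit_right := by
    have h := congrArg f J.counit_right
    rw [← counitRight_map, map_one] at h
    exact h

end Map

end Twist

end HopfTwist

end

/-! Let f be the given isomorphism of triangular Hopf algebras. Minimality says that contracting one
leg of J₂₁⁻¹J, respectively of its analogue for J', yields all of k[H], respectively k[H']. Since f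
matches the R-matrices, it maps k[H] onto k[H'] (`range_le_of_tmap_eq`, `exists_restrict`), and the
restriction g again respects twisted coproducts, counits and R-matrices.

Then K = J'(g ⊗ g)(J)⁻¹ is a twist for k[H'] (`quotient`), and the matching of R-matrices makes K
symmetric (`flip_quotient`). A symmetric twist of a finite-dimensional cocommutative Hopf algebra A
is gauge trivial (`exists_comul_mul_eq_tmul`): the operators a ↦ (φ ⊗ id)(Δ(a)K), for φ in A*,
commute, and a common eigenvector x, normalised by ε(x) = 1, satisfies Δ(x)K = x ⊗ x. Hence Δ(x)J' =
(x ⊗ x)(g ⊗ g)(J) for some x in k[H'] (`exists_conj`).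

The same x, viewed in k[G'], makes F = x f x⁻¹ compatible with the untwisted coproducts
(`exists_bialgEquiv_conj`), so F comes from a group isomorphism φ (`exists_mulEquiv_of_bialgEquiv`).
Because x lies in k[H'], F still maps k[H] onto k[H'], which gives φ(H) = H', and the equation for x
rearranges into the gauge equivalence. -/

noncomputable section

/-! ### Linear algebra: common eigenvectors and separation of tensors -/

/-- A commuting family of operators on a nonzero finite-dimensional space over an algebraically
closed field has a common eigenvector. -/
theorem Module.End.exists_common_eigenvector {k : Type*} [Field k] [IsAlgClosed k] {ι : Type*}
    (n : ℕ) : ∀ {V : Type*} [AddCommGroup V] [Module k V] [FiniteDimensional k V] [Nontrivial V]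
      (_ : Module.finrank k V ≤ n) (T : ι → Module.End k V) (_ : ∀ i j, Commute (T i) (T j)),
      ∃ v : V, v ≠ 0 ∧ ∀ i, ∃ c : k, T i v = c • v := by
  induction n with
  | zero =>
    intro V _ _ _ _ hn
    exact absurd hn (by have := Module.finrank_pos (R := k) (M := V); omega)
  | succ n ih =>
    intro V _ _ _ _ hn T hT
    -- If every operator is scalar, any nonzero vector works. Otherwise an eigenspace of a
    -- non-scalar operator is a proper subspace, stable under the whole family, to which induction
    -- applies.
    by_cases hs : ∀ i, ∃ c : k, ∀ v, T i v = c • v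
    · obtain ⟨v, hv⟩ := exists_ne (0 : V)
      exact ⟨v, hv, fun i => (hs i).imp fun c hc => hc v⟩
    · push Not at hs
      obtain ⟨i, hi⟩ := hs
      obtain ⟨μ, hμ⟩ := Module.End.exists_eigenvalue (T i)
      let W := Module.End.eigenspace (T i) μ
      have hW : ∀ j, ∀ w ∈ W, T j w ∈ W := fun j w hw => by
        rw [Module.End.mem_eigenspace_iff] at hw ⊢
        rw [← Module.End.mul_apply, (hT i j).eq, Module.End.mul_apply, hw, map_smul]
      have : Nontrivial W := Submodule.nontrivial_iff_ne_bot.mpr hμ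
      have hlt : Module.finrank k W < Module.finrank k V := Submodule.finrank_lt fun h => by
        obtain ⟨v, hv⟩ := hi μ
        exact hv (Module.End.mem_eigenspace_iff.mp (h ▸ Submodule.mem_top : v ∈ W))
      obtain ⟨w, hw, h⟩ := ih (V := W) (by omega) (fun j => (T j).restrict (hW j))
        fun j l => by
          ext w
          exact LinearMap.congr_fun (hT j l).eq (w : V)
      refine ⟨w, by simpa using hw, fun j => (h j).imp fun c hc => ?_⟩
      exact congrArg Subtype.val hc

namespace HopfTwist

/-- Elements of `A ⊗ B` are separated by the maps `φ ⊗ id`. -/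
lemma tensor_ext_of_rTensor {k A B : Type*} [Field k] [AddCommGroup A] [Module k A]
    [AddCommGroup B] [Module k B] {y z : A ⊗[k] B}
    (h : ∀ φ : Module.Dual k A, TensorProduct.lid k B (φ.rTensor B y) =
      TensorProduct.lid k B (φ.rTensor B z)) : y = z := by
  classical
  let b := Module.Basis.ofVectorSpace k A
  apply (TensorProduct.equivFinsuppOfBasisLeft b).injective
  ext i
  simpa [TensorProduct.equivFinsuppOfBasisLeft_apply] using h (b.coord i)

namespace Twist

/-! ### Symmetric twists are gauge trivial -/

section Symmetric

variable {k A : Type*} [CommRing k] [Ring A] [HopfAlgebra k A] (K : Twist k A)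

/-- The operator `a ↦ (φ ⊗ id)(Δ(a) K)`. -/
def slice (φ : Module.Dual k A) : A →ₗ[k] A :=
  (TensorProduct.lid k A).toLinearMap ∘ₗ φ.rTensor A ∘ₗ
    LinearMap.mulRight k (K.elt : A ⊗[k] A) ∘ₗ Coalgebra.comul

lemma slice_apply (φ : Module.Dual k A) (a : A) : K.slice φ a =
    TensorProduct.lid k A (φ.rTensor A (Coalgebra.comul (R := k) a * K.elt)) := rfl

/-- `a ⊗ b ⊗ c ↦ φ(a) ψ(b) c`. -/
def slice₂ (φ ψ : Module.Dual k A) : A ⊗[k] (A ⊗[k] A) →ₗ[k] A :=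
  (TensorProduct.lid k A).toLinearMap ∘ₗ
    TensorProduct.map φ ((TensorProduct.lid k A).toLinearMap ∘ₗ ψ.rTensor A)

lemma slice₂_swap12 (φ ψ : Module.Dual k A) (z : A ⊗[k] (A ⊗[k] A)) :
    slice₂ φ ψ (swap12 z) = slice₂ ψ φ z := by
  induction z with
  | zero => simp
  | add z w hz hw => simp only [map_add, hz, hw]
  | tmul a y =>
    induction y with
    | zero => simp
    | add z w hz hw => simp only [map_add, TensorProduct.tmul_add, hz, hw]
    | tmul b c => simp [slice₂, swap12_tmul, smul_smul, mul_comm]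

lemma slice_rTensor (φ ψ : Module.Dual k A) (y : A ⊗[k] A) :
    K.slice φ (TensorProduct.lid k A (ψ.rTensor A y)) =
      slice₂ ψ φ (comulRight k A y * leg23 k A K.elt) := by
  induction y with
  | zero => simp
  | add z w hz hw => simp only [map_add, add_mul, hz, hw]
  | tmul u v => simp [slice₂, comulRight_tmul, leg23_apply, slice_apply]

/-- Coassociativity and the cocycle identity turn the composite into a contraction of (Δ ⊗
id)(Δ(a)K)(K ⊗ 1), whose first two legs can be exchanged when everything is symmetric. -/
lemma slice_slice (φ ψ : Module.Dual k A) (a : A) : K.slice φ (K.slice ψ a) =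
    slice₂ ψ φ (comulLeft k A (Coalgebra.comul (R := k) a) *
      (comulLeft k A K.elt * leg12 k A K.elt)) := by
  have hΔ : comulLeft k A (Coalgebra.comul (R := k) a) =
      comulRight k A (Coalgebra.comul (R := k) a) := Coalgebra.coassoc_apply a
  rw [K.slice_apply ψ, slice_rTensor, map_mul (comulRight k A), mul_assoc, K.cocycle, hΔ]

/-- Exchanging the first two legs fixes Δ ⊗ id by cocommutativity and K ⊗ 1 by symmetry of K, so it
only interchanges the two functionals. -/
lemma commute_slice [Coalgebra.IsCocomm k A] (hK : flip k A K.elt = K.elt)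
    (φ ψ : Module.Dual k A) : Commute (K.slice φ : Module.End k A) (K.slice ψ) := by
  refine LinearMap.ext fun a => ?_
  have h1 := fun z => AlgHom.congr_fun (swap12_comulLeft (k := k) (A := A)) z
  have h2 := fun z => AlgHom.congr_fun (swap12_leg12 (k := k) (A := A)) z
  simp only [AlgHom.comp_apply] at h1 h2
  rw [Module.End.mul_apply, Module.End.mul_apply, slice_slice, slice_slice, ← slice₂_swap12]
  simp only [map_mul, h1, h2, hK]

/-- Contracting the left leg commutes with applying ε to the right one, and (id ⊗ ε)(K) = 1. This
lets ε determine the eigenvalues of a common eigenvector. -/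
lemma counit_slice (φ : Module.Dual k A) (a : A) :
    Coalgebra.counit (R := k) (K.slice φ a) = φ a := by
  have h (y : A ⊗[k] A) : Coalgebra.counit (R := k) (TensorProduct.lid k A (φ.rTensor A y)) =
      φ (counitRight k A y) := by
    induction y with
    | zero => simp
    | add z w hz hw => simp only [map_add, hz, hw]
    | tmul u v => simp [counitRight_tmul, mul_comm]
  have h' : counitRight k A (Coalgebra.comul (R := k) a) = a := by
    have := congrArg (TensorProduct.rid k A) (Coalgebra.lTensor_counit_comul (R := k) a)
    rw [TensorProduct.rid_tmul, one_smul] at this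
    exact this
  rw [slice_apply, h, map_mul, K.counit_right, mul_one, h']

end Symmetric

/-- A symmetric twist of a finite-dimensional cocommutative Hopf algebra over an algebraically
closed field is gauge equivalent to the trivial twist. -/
theorem exists_comul_mul_eq_tmul {k A : Type*} [Field k] [IsAlgClosed k] [Ring A]
    [HopfAlgebra k A] [Coalgebra.IsCocomm k A] [FiniteDimensional k A] (K : Twist k A)
    (hK : flip k A K.elt = K.elt) :
    ∃ x : Aˣ, Coalgebra.counit (R := k) (x : A) = 1 ∧
      Coalgebra.comul (R := k) (x : A) * K.elt = (x : A) ⊗ₜ[k] (x : A) := by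
  have : Nontrivial A := ⟨0, 1, fun h => by
    simpa using congrArg (Coalgebra.counit (R := k) (A := A)) h⟩
  obtain ⟨v, hv, h⟩ := Module.End.exists_common_eigenvector (k := k) _ le_rfl
    (fun φ : Module.Dual k A => (K.slice φ : Module.End k A)) (K.commute_slice hK)
  -- Applying ε to T_φ v = c v gives φ(v) = c ε(v). The eigenvalue equation is kept free of division
  -- because ε(v) ≠ 0 is deduced from it: were ε(v) zero, every φ(v) would vanish.
  have hφ (φ : Module.Dual k A) :
      Coalgebra.counit (R := k) v • K.slice φ v = φ v • v := by
    obtain ⟨c, hc⟩ := h φ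
    have := K.counit_slice φ v
    rw [hc] at this ⊢
    rw [← this, map_smul, smul_smul, smul_eq_mul, mul_comm]
  have hε : Coalgebra.counit (R := k) v ≠ 0 := fun h0 => hv <| by
    refine (Module.forall_dual_apply_eq_zero_iff k v).mp fun φ => ?_
    have := hφ φ
    rw [h0, zero_smul] at this
    exact (smul_eq_zero.mp this.symm).resolve_right hv
  set e := Coalgebra.counit (R := k) v with he
  let x : A := e⁻¹ • v
  have hx1 : Coalgebra.counit (R := k) x = 1 := by simp [x, ← he, hε]
  have hx : Coalgebra.comul (R := k) x * K.elt = x ⊗ₜ[k] x := by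
    refine tensor_ext_of_rTensor fun φ => ?_
    rw [← slice_apply, LinearMap.rTensor_tmul, TensorProduct.lid_tmul]
    simp only [x, map_smul, smul_eq_mul]
    rw [mul_smul, smul_comm (φ v), ← hφ φ, inv_smul_smul₀ hε]
  -- In a Noetherian ring a one-sided inverse is two-sided.
  have : IsNoetherianRing A := IsNoetherianRing.of_finite k A
  obtain ⟨u, hu⟩ : IsUnit x := by
    -- The right inverse comes from applying m(id ⊗ S) to Δ(x) = (x ⊗ x)K⁻¹: the left side becomes
    -- ε(x) = 1, the right side x · m(id ⊗ S)(K⁻¹) · S(x).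
    refine IsUnit.of_mul_eq_one (sandwichRight 1 ((K.elt⁻¹ : (A ⊗[k] A)ˣ) : A ⊗[k] A) *
      HopfAlgebra.antipode k x) ?_
    have h1 : Coalgebra.comul (R := k) x = x ⊗ₜ[k] x * ((K.elt⁻¹ : (A ⊗[k] A)ˣ) : A ⊗[k] A) := by
      rw [← hx, mul_assoc, Units.mul_inv, mul_one]
    have h2 := sandwichRight_comul (k := k) x
    rw [h1, sandwichRight_mul, sandwichRight_tmul, hx1, map_one, mul_assoc] at h2
    exact h2
  exact ⟨u, by rw [hu, hx1], by rw [hu, hx]⟩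


/-! ### Comparing two twists along a homomorphism of twisted bialgebras -/

section Compare

variable {k A B : Type*} [CommRing k] [Ring A] [HopfAlgebra k A] [Ring B] [HopfAlgebra k B]

/-- Both sides invert the common value of the two sides of the cocycle identity. -/
lemma leg12_inv_mul_comulLeft_inv (J : Twist k A) :
    leg12 k A (J.elt⁻¹ : (A ⊗[k] A)ˣ) * comulLeft k A (J.elt⁻¹ : (A ⊗[k] A)ˣ) =
      leg23 k A (J.elt⁻¹ : (A ⊗[k] A)ˣ) * comulRight k A (J.elt⁻¹ : (A ⊗[k] A)ˣ) := by
  refine left_inv_eq_right_inv (a := comulLeft k A J.elt * leg12 k A J.elt) ?_ ?_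
  · rw [mul_assoc, ← mul_assoc (comulLeft k A _), J.map_inv_mul, one_mul, J.map_inv_mul]
  · rw [J.cocycle, mul_assoc, ← mul_assoc (leg23 k A _), J.map_mul_inv, one_mul, J.map_mul_inv]

variable (J : Twist k A) (J' : Twist k B) (f : A →ₐ[k] B)

/-- `f ⊗ f` for an algebra homomorphism `f`. -/
def tmap (f : A →ₐ[k] B) : A ⊗[k] A →ₐ[k] B ⊗[k] B := Algebra.TensorProduct.map f f

/-- `f ⊗ f ⊗ f` for an algebra homomorphism `f`. -/
def tmap₃ (f : A →ₐ[k] B) : A ⊗[k] (A ⊗[k] A) →ₐ[k] B ⊗[k] (B ⊗[k] B) :=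
  Algebra.TensorProduct.map f (tmap f)

lemma tmap_tmul (a b : A) : tmap f (a ⊗ₜ[k] b) = f a ⊗ₜ f b := rfl

lemma tmap_flip (y : A ⊗[k] A) : tmap f (flip k A y) = flip k B (tmap f y) := by
  induction y with
  | zero => simp
  | add y z hy hz => simp only [map_add, hy, hz]
  | tmul a b => rfl

lemma tmap₃_leg12 (y : A ⊗[k] A) : tmap₃ f (leg12 k A y) = leg12 k B (tmap f y) := by
  induction y with
  | zero => simp
  | add y z hy hz => simp only [map_add, hy, hz]
  | tmul a b => simp [leg12_tmul, tmap₃, tmap]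

lemma tmap₃_leg23 (y : A ⊗[k] A) : tmap₃ f (leg23 k A y) = leg23 k B (tmap f y) := by
  simp [leg23_apply, tmap₃]

lemma tmap₃_assoc (y : A ⊗[k] A) (a : A) :
    tmap₃ f (Algebra.TensorProduct.assoc k k k A A A (y ⊗ₜ a)) =
      Algebra.TensorProduct.assoc k k k B B B (tmap f y ⊗ₜ f a) := by
  induction y with
  | zero => simp
  | add y z hy hz => simp only [map_add, TensorProduct.add_tmul, hy, hz]
  | tmul a b => rfl

variable {J J' f}

/-- The map f intertwines the twisted coproducts, not Δ itself, so moving Δ ⊗ id across f ⊗ f costs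
a conjugation by each twist. This and its mirror `comulRight_tmap_mul` drive the cocycle identity
for `quotient`. -/
lemma comulLeft_tmap_mul (hf : ∀ a, J'.comul (f a) = tmap f (J.comul a)) (y : A ⊗[k] A) :
    comulLeft k B (tmap f y) * leg12 k B J'.elt = leg12 k B J'.elt *
      tmap₃ f (leg12 k A (J.elt⁻¹ : (A ⊗[k] A)ˣ) * comulLeft k A y * leg12 k A J.elt) := by
  have h : Algebra.TensorProduct.assoc k k k B B B
      (Algebra.TensorProduct.map J'.comul (AlgHom.id k B) (tmap f y)) =
      tmap₃ f (Algebra.TensorProduct.assoc k k k A A A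
        (Algebra.TensorProduct.map J.comul (AlgHom.id k A) y)) := by
    induction y with
    | zero => simp
    | add y z hy hz => simp only [map_add, hy, hz]
    | tmul a b =>
      rw [tmap_tmul, Algebra.TensorProduct.map_tmul, Algebra.TensorProduct.map_tmul, hf,
        tmap₃_assoc]
      rfl
  rw [assoc_map_comul, assoc_map_comul] at h
  rw [← h, mul_assoc, ← mul_assoc, J'.map_mul_inv, one_mul]

lemma comulRight_tmap_mul (hf : ∀ a, J'.comul (f a) = tmap f (J.comul a)) (y : A ⊗[k] A) :
    comulRight k B (tmap f y) * leg23 k B J'.elt = leg23 k B J'.elt *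
      tmap₃ f (leg23 k A (J.elt⁻¹ : (A ⊗[k] A)ˣ) * comulRight k A y * leg23 k A J.elt) := by
  have h : Algebra.TensorProduct.map (AlgHom.id k B) J'.comul (tmap f y) =
      tmap₃ f (Algebra.TensorProduct.map (AlgHom.id k A) J.comul y) := by
    induction y with
    | zero => simp
    | add y z hy hz => simp only [map_add, hy, hz]
    | tmul a b =>
      rw [tmap_tmul, Algebra.TensorProduct.map_tmul, Algebra.TensorProduct.map_tmul, hf]
      rfl
  rw [map_id_comul, map_id_comul] at h
  rw [← h, mul_assoc, ← mul_assoc, J'.map_mul_inv, one_mul]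

lemma counitLeft_tmap (hε : ∀ a, Coalgebra.counit (R := k) (f a) = Coalgebra.counit (R := k) a)
    (y : A ⊗[k] A) : counitLeft k B (tmap f y) = f (counitLeft k A y) := by
  induction y with
  | zero => simp
  | add y z hy hz => simp only [map_add, hy, hz]
  | tmul a b => simp [tmap_tmul, counitLeft_tmul, hε]

lemma counitRight_tmap (hε : ∀ a, Coalgebra.counit (R := k) (f a) = Coalgebra.counit (R := k) a)
    (y : A ⊗[k] A) : counitRight k B (tmap f y) = f (counitRight k A y) := by
  induction y with
  | zero => simp
  | add y z hy hz => simp only [map_add, hy, hz]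
  | tmul a b => simp [tmap_tmul, counitRight_tmul, hε]

variable (J J' f) in
/-- The twist `J' (f ⊗ f)(J)⁻¹` for `B`, where `f : Aᴶ → Bᴶ'` is a homomorphism of bialgebras. -/
def quotient (hf : ∀ a, J'.comul (f a) = tmap f (J.comul a))
    (hε : ∀ a, Coalgebra.counit (R := k) (f a) = Coalgebra.counit (R := k) a) : Twist k B where
  elt := J'.elt * Units.map (tmap f : A ⊗[k] A →* B ⊗[k] B) J.elt⁻¹
  cocycle := by
    change comulLeft k B (J'.elt * tmap f (J.elt⁻¹ : (A ⊗[k] A)ˣ)) *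
      leg12 k B (J'.elt * tmap f (J.elt⁻¹ : (A ⊗[k] A)ˣ)) =
      comulRight k B (J'.elt * tmap f (J.elt⁻¹ : (A ⊗[k] A)ˣ)) *
      leg23 k B (J'.elt * tmap f (J.elt⁻¹ : (A ⊗[k] A)ˣ))
    simp only [map_mul]
    -- The left side becomes (Δ ⊗ id)(J') J'₁₂ times the image under f of J₁₂⁻¹ (Δ ⊗ id)(J⁻¹). The
    -- cocycle identities for J' and J⁻¹ convert the two factors separately, and the right side is
    -- then reached by undoing the same reduction.
    rw [mul_assoc, ← mul_assoc _ (leg12 k B J'.elt), comulLeft_tmap_mul hf, mul_assoc,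
      ← tmap₃_leg12, ← map_mul (tmap₃ f), mul_assoc _ (leg12 k A J.elt), J.map_mul_inv, mul_one,
      leg12_inv_mul_comulLeft_inv, ← mul_assoc, J'.cocycle]
    rw [mul_assoc (comulRight k B J'.elt) _ (_ * _), ← mul_assoc _ (leg23 k B J'.elt),
      comulRight_tmap_mul hf, mul_assoc (leg23 k B J'.elt),
      ← tmap₃_leg23, ← map_mul (tmap₃ f), mul_assoc _ (leg23 k A J.elt), J.map_mul_inv, mul_one,
      mul_assoc]
  counit_left := by
    change counitLeft k B (J'.elt * tmap f (J.elt⁻¹ : (A ⊗[k] A)ˣ)) = 1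
    rw [map_mul, J'.counit_left, counitLeft_tmap hε, J.counit_left_inv, map_one, one_mul]
  counit_right := by
    change counitRight k B (J'.elt * tmap f (J.elt⁻¹ : (A ⊗[k] A)ˣ)) = 1
    rw [map_mul, J'.counit_right, counitRight_tmap hε, J.counit_right_inv, map_one, one_mul]

lemma quotient_elt (hf : ∀ a, J'.comul (f a) = tmap f (J.comul a))
    (hε : ∀ a, Coalgebra.counit (R := k) (f a) = Coalgebra.counit (R := k) a) :
    ((quotient J J' f hf hε).elt : B ⊗[k] B) = J'.elt * tmap f (J.elt⁻¹ : (A ⊗[k] A)ˣ) := rfl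

/-- Multiplying `hR` on the left by J'₂₁ and on the right by (f ⊗ f)(J)⁻¹ yields this symmetry. -/
lemma flip_quotient (hf : ∀ a, J'.comul (f a) = tmap f (J.comul a))
    (hε : ∀ a, Coalgebra.counit (R := k) (f a) = Coalgebra.counit (R := k) a)
    (hR : tmap f (flip k A (J.elt⁻¹ : (A ⊗[k] A)ˣ) * J.elt) =
      flip k B (J'.elt⁻¹ : (B ⊗[k] B)ˣ) * J'.elt) :
    flip k B (quotient J J' f hf hε).elt = (quotient J J' f hf hε).elt := by
  rw [quotient_elt, map_mul, ← tmap_flip]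
  have := congrArg (fun t => flip k B J'.elt * t * tmap f (J.elt⁻¹ : (A ⊗[k] A)ˣ)) hR
  simpa only [map_mul, ← mul_assoc, J'.map_mul_inv, one_mul,
    mul_assoc _ (tmap f (J.elt : A ⊗[k] A)), J.map_mul_inv, mul_one] using this

end Compare

/-- A homomorphism of triangular Hopf algebras `Aᴶ → Bᴶ'` becomes a homomorphism of Hopf algebras
`A → B` after conjugation by some `x ∈ B`, and it sends `J` to a twist gauge equivalent
to `J'`. -/
theorem exists_conj {k A B : Type*} [Field k] [IsAlgClosed k] [Ring A] [HopfAlgebra k A]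
    [Ring B] [HopfAlgebra k B] [Coalgebra.IsCocomm k B] [FiniteDimensional k B]
    {J : Twist k A} {J' : Twist k B} {f : A →ₐ[k] B}
    (hf : ∀ a, J'.comul (f a) = tmap f (J.comul a))
    (hε : ∀ a, Coalgebra.counit (R := k) (f a) = Coalgebra.counit (R := k) a)
    (hR : tmap f (flip k A (J.elt⁻¹ : (A ⊗[k] A)ˣ) * J.elt) =
      flip k B (J'.elt⁻¹ : (B ⊗[k] B)ˣ) * J'.elt) :
    ∃ x : Bˣ, Coalgebra.counit (R := k) (x : B) = 1 ∧
      Coalgebra.comul (R := k) (x : B) * J'.elt = ((x : B) ⊗ₜ[k] (x : B)) * tmap f J.elt := by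
  obtain ⟨x, hx, h⟩ := (quotient J J' f hf hε).exists_comul_mul_eq_tmul (flip_quotient hf hε hR)
  refine ⟨x, hx, ?_⟩
  rw [← h, quotient_elt, ← mul_assoc, mul_assoc _ _ (tmap f J.elt), J.map_inv_mul, mul_one]

end Twist

/-! ### Recovering the minimal part from the R-matrix -/

/-- Naturality of contraction: it reduces contractions in a larger algebra to `dualMap`, so that
subalgebras carrying the same tensor can be compared there. -/
lemma lid_rTensor_tmap {k A C : Type*} [CommRing k] [Ring A] [HopfAlgebra k A] [Ring C]
    [HopfAlgebra k C] (α : A →ₐ[k] C) (φ : Module.Dual k C) (y : A ⊗[k] A) :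
    TensorProduct.lid k C (φ.rTensor C (Twist.tmap α y)) =
      α (dualMap y (φ ∘ₗ α.toLinearMap)) := by
  change _ = α (TensorProduct.lid k A ((φ ∘ₗ α.toLinearMap).rTensor A y))
  induction y with
  | zero => simp
  | add y z hy hz => simp only [map_add, hy, hz]
  | tmul a b => simp [Twist.tmap_tmul]

/-- The left legs of `(α ⊗ α)(R) = (β ⊗ β)(R')` span `range α` if `R` is nondegenerate and `α` is
injective, and they lie in `range β`. -/
lemma range_le_of_tmap_eq {k A B C : Type*} [Field k] [Ring A] [HopfAlgebra k A] [Ring B]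
    [HopfAlgebra k B] [Ring C] [HopfAlgebra k C] {α : A →ₐ[k] C} {β : B →ₐ[k] C}
    (hα : Function.Injective α) {R : A ⊗[k] A} {R' : B ⊗[k] B}
    (hR : Function.Surjective (dualMap R)) (h : Twist.tmap α R = Twist.tmap β R') :
    α.range ≤ β.range := by
  rintro _ ⟨a, rfl⟩
  obtain ⟨ψ, rfl⟩ := hR a
  -- A linear retraction γ extends the functional ψ from A to C, where it can be restricted to B
  -- along β.
  obtain ⟨γ, hγ⟩ := LinearMap.exists_leftInverse_of_injective α.toLinearMap
    (LinearMap.ker_eq_bot.mpr hα)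
  have hψ : ψ = (ψ ∘ₗ γ) ∘ₗ α.toLinearMap := by rw [LinearMap.comp_assoc, hγ, LinearMap.comp_id]
  refine ⟨dualMap R' ((ψ ∘ₗ γ) ∘ₗ β.toLinearMap), ?_⟩
  change β _ = α _
  rw [← lid_rTensor_tmap, ← h, lid_rTensor_tmap, ← hψ]

namespace Twist

/-! ### Passing between twisted and untwisted structures -/

section

variable {k A B C D : Type*} [CommRing k] [Ring A] [HopfAlgebra k A] [Ring B] [HopfAlgebra k B]
  [Ring C] [HopfAlgebra k C] [Ring D] [HopfAlgebra k D]

/-- An isomorphism of twisted triangular Hopf algebras, in terms of the untwisted algebras. -/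
lemma exists_algEquiv_of_triangularIso {J : Twist k A} {J' : Twist k B}
    (h : TriangularIso J.rMatrix J'.rMatrix) :
    ∃ f : A ≃ₐ[k] B, (∀ a, J'.comul (f a) = tmap (f : A →ₐ[k] B) (J.comul a)) ∧
      (∀ a, Coalgebra.counit (R := k) (f a) = Coalgebra.counit (R := k) a) ∧
      tmap (f : A →ₐ[k] B) (flip k A (J.elt⁻¹ : (A ⊗[k] A)ˣ) * J.elt) =
        flip k B (J'.elt⁻¹ : (B ⊗[k] B)ˣ) * J'.elt := by
  obtain ⟨f, hf⟩ := h
  let g : A ≃ₐ[k] B := (f : J.Twisted ≃ₐ[k] J'.Twisted)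
  refine ⟨g, fun a => ?_, fun a => ?_, hf⟩
  · exact (CoalgHomClass.map_comp_comul_apply (R := k) (A := J.Twisted) (B := J'.Twisted) f a).symm
  · exact CoalgHomClass.counit_comp_apply (R := k) (A := J.Twisted) (B := J'.Twisted) f a

lemma tmap_comp (g : B →ₐ[k] C) (f : A →ₐ[k] B) (y : A ⊗[k] A) :
    tmap (g.comp f) y = tmap g (tmap f y) := by
  induction y with
  | zero => simp
  | add y z hy hz => simp only [map_add, hy, hz]
  | tmul a b => rfl

lemma tmap_comul (f : A →ₐc[k] B) (a : A) :
    tmap (f : A →ₐ[k] B) (Coalgebra.comul (R := k) a) = Coalgebra.comul (R := k) (f a) :=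
  map₂_comul f a

lemma map_elt (J : Twist k A) (f : A →ₐc[k] B) :
    ((J.map f).elt : B ⊗[k] B) = tmap (f : A →ₐ[k] B) J.elt := rfl

lemma map_elt_inv (J : Twist k A) (f : A →ₐc[k] B) :
    (((J.map f).elt⁻¹ : (B ⊗[k] B)ˣ) : B ⊗[k] B) =
      tmap (f : A →ₐ[k] B) (J.elt⁻¹ : (A ⊗[k] A)ˣ) := rfl

lemma map_comul (J : Twist k A) (f : A →ₐc[k] B) (a : A) :
    (J.map f).comul (f a) = tmap (f : A →ₐ[k] B) (J.comul a) := by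
  rw [comul_apply, comul_apply, map_mul, map_mul, map_elt, map_elt_inv, tmap_comul]

lemma tmap_rMatrix (J : Twist k A) (f : A →ₐc[k] B) :
    tmap (f : A →ₐ[k] B) (flip k A (J.elt⁻¹ : (A ⊗[k] A)ˣ) * J.elt) =
      flip k B ((J.map f).elt⁻¹ : (B ⊗[k] B)ˣ) * (J.map f).elt := by
  rw [map_mul, tmap_flip, map_elt, map_elt_inv]

lemma tmap_conj (f g : A →ₐ[k] B) (x : Bˣ) (h : ∀ a, g a = x * f a * (x⁻¹ : Bˣ))
    (y : A ⊗[k] A) :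
    tmap g y = ((x : B) ⊗ₜ[k] (x : B)) * tmap f y * (((x⁻¹ : Bˣ) : B) ⊗ₜ[k] ((x⁻¹ : Bˣ) : B)) := by
  induction y with
  | zero => simp
  | add y z hy hz => simp only [map_add, mul_add, add_mul, hy, hz]
  | tmul a b => simp [tmap_tmul, h]

lemma tmul_inv_mul_tmul (x : Bˣ) :
    (((x⁻¹ : Bˣ) : B) ⊗ₜ[k] ((x⁻¹ : Bˣ) : B)) * ((x : B) ⊗ₜ[k] (x : B)) = 1 := by
  simp [Algebra.TensorProduct.one_def]

/-- An isomorphism `Aᴶ → Bᴶ'`, conjugated by `x` with `Δ(x) J' = (x ⊗ x) (f ⊗ f)(J)`, is an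
isomorphism `A → B`. -/
lemma exists_bialgEquiv_conj {J : Twist k A} {J' : Twist k B} {f : A ≃ₐ[k] B}
    (hf : ∀ a, J'.comul (f a) = tmap (f : A →ₐ[k] B) (J.comul a))
    (hε : ∀ a, Coalgebra.counit (R := k) (f a) = Coalgebra.counit (R := k) a) {x : Bˣ}
    (h : Coalgebra.comul (R := k) (x : B) * J'.elt =
      ((x : B) ⊗ₜ[k] (x : B)) * tmap (f : A →ₐ[k] B) J.elt) :
    ∃ F : A ≃ₐc[k] B, ∀ a, F a = x * f a * (x⁻¹ : Bˣ) := by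
  let c : B ≃ₐ[k] B := MulSemiringAction.toAlgEquiv k B (ConjAct.toConjAct x)
  have hc (b : B) : c b = x * b * (x⁻¹ : Bˣ) := rfl
  let e : A ≃ₐ[k] B := f.trans c
  have he (a : A) : e a = x * f a * (x⁻¹ : Bˣ) := rfl
  refine ⟨BialgEquiv.ofAlgEquiv e ?_ ?_, he⟩
  · refine AlgHom.ext fun a => ?_
    change Bialgebra.counitAlgHom k B (e a) = _
    rw [he, map_mul, map_mul, mul_right_comm, ← map_mul, Units.mul_inv, map_one, one_mul]
    exact hε a
  · refine AlgHom.ext fun a => ?_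
    change tmap (e : A →ₐ[k] B) (Coalgebra.comul (R := k) a) =
      Bialgebra.comulAlgHom k B (e a)
    have h1 : Bialgebra.comulAlgHom k B (f a) * J'.elt = J'.elt * tmap (f : A →ₐ[k] B)
        ((J.elt⁻¹ : (A ⊗[k] A)ˣ) * Coalgebra.comul (R := k) a * J.elt) := by
      rw [← comul_apply, ← hf, comul_apply, mul_assoc, Units.mul_inv_cancel_left]
      rfl
    -- This is multiplicativity of Δ on F(a)x = x f(a), arranged without Δ(x)⁻¹. It is checked after
    -- right multiplication by the invertible J', where the equation for Δ(x)J' applies.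
    have h2 : Bialgebra.comulAlgHom k B x * Bialgebra.comulAlgHom k B (f a) =
        ((x : B) ⊗ₜ[k] (x : B)) * tmap (f : A →ₐ[k] B) (Coalgebra.comul (R := k) a) *
          (((x⁻¹ : Bˣ) : B) ⊗ₜ[k] ((x⁻¹ : Bˣ) : B)) * Bialgebra.comulAlgHom k B x := by
      rw [← Units.mul_left_inj J'.elt, mul_assoc, h1, ← mul_assoc]
      change Coalgebra.comul (R := k) (x : B) * _ * _ = _ * Coalgebra.comul (R := k) (x : B) * _
      rw [mul_assoc _ (Coalgebra.comul (R := k) (x : B)), h, map_mul, map_mul]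
      simp only [← mul_assoc]
      rw [mul_assoc _ (tmap (f : A →ₐ[k] B) J.elt), J.map_mul_inv, mul_one,
        mul_assoc _ _ ((x : B) ⊗ₜ[k] (x : B)), tmul_inv_mul_tmul, mul_one]
    rw [tmap_conj (f : A →ₐ[k] B) (e : A →ₐ[k] B) x he, he, map_mul, map_mul, h2, mul_assoc _ (Bialgebra.comulAlgHom k B x),
      ← map_mul, Units.mul_inv, map_one, mul_one]

end

/-- An isomorphism between the images of two minimal twists under injective Hopf algebra maps
restricts to the minimal parts. -/
theorem exists_restrict {k A B C D : Type*} [Field k] [Ring A] [HopfAlgebra k A] [Ring B]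
    [HopfAlgebra k B] [Ring C] [HopfAlgebra k C] [Ring D] [HopfAlgebra k D]
    {J : Twist k A} {J' : Twist k B} (hJ : J.IsMinimal) (hJ' : J'.IsMinimal)
    {ι : A →ₐc[k] C} {ι' : B →ₐc[k] D} (hι : Function.Injective ι) (hι' : Function.Injective ι')
    {f : C ≃ₐ[k] D}
    (hf : ∀ a, (J'.map ι').comul (f a) = tmap (f : C →ₐ[k] D) ((J.map ι).comul a))
    (hε : ∀ a, Coalgebra.counit (R := k) (f a) = Coalgebra.counit (R := k) a)
    (hR : tmap (f : C →ₐ[k] D)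
        (flip k C ((J.map ι).elt⁻¹ : (C ⊗[k] C)ˣ) * (J.map ι).elt) =
      flip k D ((J'.map ι').elt⁻¹ : (D ⊗[k] D)ˣ) * (J'.map ι').elt) :
    ∃ g : A →ₐ[k] B, (∀ a, ι' (g a) = f (ι a)) ∧ Function.Surjective g ∧
      (∀ a, J'.comul (g a) = tmap g (J.comul a)) ∧
      (∀ a, Coalgebra.counit (R := k) (g a) = Coalgebra.counit (R := k) a) ∧
      tmap g (flip k A (J.elt⁻¹ : (A ⊗[k] A)ˣ) * J.elt) =
        flip k B (J'.elt⁻¹ : (B ⊗[k] B)ˣ) * J'.elt := by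
  let α : A →ₐ[k] D := (f : C →ₐ[k] D).comp (ι : A →ₐ[k] C)
  let β : B →ₐ[k] D := ι'
  have hα : Function.Injective α := f.injective.comp hι
  rw [← tmap_rMatrix, ← tmap_rMatrix, ← tmap_comp] at hR
  -- Both R-matrices have the same image in D ⊗ D, and each determines its own subalgebra by
  -- minimality; hence the two ranges coincide.
  have h1 : α.range ≤ β.range := range_le_of_tmap_eq hα hJ.bijective.2 hR
  have h2 : β.range ≤ α.range := range_le_of_tmap_eq hι' hJ'.bijective.2 hR.symm
  let g : A →ₐ[k] B := ((AlgEquiv.ofInjective β hι').symm : β.range →ₐ[k] B).comp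
    (α.codRestrict β.range fun a => h1 ⟨a, rfl⟩)
  have hg (a : A) : ι' (g a) = f (ι a) :=
    congrArg Subtype.val ((AlgEquiv.ofInjective β hι').apply_symm_apply ⟨α a, h1 ⟨a, rfl⟩⟩)
  have hgα : β.comp g = α := AlgHom.ext hg
  -- Over a field B ⊗ B embeds into D ⊗ D, so the tensor identities for g can be tested there, where
  -- they follow from those for f.
  have hinj : Function.Injective (tmap β) :=
    TensorProduct.map_injective_of_flat_flat β.toLinearMap β.toLinearMap hι' hι'
  have hgt (y : A ⊗[k] A) : tmap β (tmap g y) = tmap (f : C →ₐ[k] D) (tmap (ι : A →ₐ[k] C) y) := by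
    rw [← tmap_comp, hgα, tmap_comp]
  refine ⟨g, hg, fun b => ?_, fun a => hinj ?_, fun a => ?_, hinj ?_⟩
  · obtain ⟨a, ha⟩ := h2 ⟨b, rfl⟩
    exact ⟨a, hι' ((hg a).trans ha)⟩
  · rw [hgt, ← map_comul J, ← hf, ← hg]
    exact (map_comul J' ι' (g a)).symm
  · rw [← CoalgHomClass.counit_comp_apply (R := k) ι', hg, hε,
      CoalgHomClass.counit_comp_apply (R := k) ι]
  · rw [← tmap_comp, hgα]
    exact hR

end Twist

/-! ### Group algebras -/

/-- The image of k[H] is supported on H. This is how statements about subalgebras return to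
statements about subgroups. -/
lemma mem_of_mapDomain_subtype_eq_single {k G : Type*} [Field k] [Group G] {H : Subgroup G}
    {y : MonoidAlgebra k H} {g : G}
    (h : MonoidAlgebra.mapDomainBialgHom k H.subtype y = MonoidAlgebra.single g 1) : g ∈ H := by
  by_contra hg
  have h1 : (MonoidAlgebra.mapDomainBialgHom k H.subtype y).coeff g = 0 :=
    Finsupp.mapDomain_of_notMem_range _ _ (by simpa using hg)
  rw [h] at h1
  simp at h1


/-- An isomorphism of group algebras as bialgebras comes from a group isomorphism. -/
lemma exists_mulEquiv_of_bialgEquiv {k G G' : Type*} [Field k] [Group G] [Group G']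
    (F : MonoidAlgebra k G ≃ₐc[k] MonoidAlgebra k G') :
    ∃ φ : G ≃* G', ∀ g, F (MonoidAlgebra.single g 1) = MonoidAlgebra.single (φ g) 1 := by
  -- Bialgebra maps preserve group-like elements, which in a group algebra over a field are the
  -- group elements; p and q are the maps induced on them by F and its inverse.
  let p := MonoidAlgebra.mapDomainOfBialgHom (F : MonoidAlgebra k G →ₐc[k] MonoidAlgebra k G')
  let q := MonoidAlgebra.mapDomainOfBialgHom
    (F.symm : MonoidAlgebra k G' →ₐc[k] MonoidAlgebra k G)
  have hp (g : G) : MonoidAlgebra.single (p g) (1 : k) = F (MonoidAlgebra.single g 1) :=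
    MonoidAlgebra.single_mapDomainOfBialgHom _ g 1
  have hq (g : G') : MonoidAlgebra.single (q g) (1 : k) = F.symm (MonoidAlgebra.single g 1) :=
    MonoidAlgebra.single_mapDomainOfBialgHom _ g 1
  refine ⟨MulEquiv.ofBijective p ⟨fun a b hab => ?_, fun g => ⟨q g, ?_⟩⟩, fun g => (hp g).symm⟩
  · refine MonoidAlgebra.single_left_injective (R := k) one_ne_zero (F.injective ?_)
    change F (MonoidAlgebra.single a 1) = F (MonoidAlgebra.single b 1)
    rw [← hp, ← hp, hab]
  · refine MonoidAlgebra.single_left_injective (R := k) one_ne_zero ?_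
    change MonoidAlgebra.single (p (q g)) (1 : k) = MonoidAlgebra.single g 1
    rw [hp, hq]
    exact F.toEquiv.apply_symm_apply _

lemma mapDomain_subtype_injective {k G : Type*} [Field k] [Group G] (H : Subgroup G) :
    Function.Injective (MonoidAlgebra.mapDomainBialgHom k H.subtype) :=
  MonoidAlgebra.mapDomain_injective H.subtype_injective

end HopfTwist

end

/-! ### The theorem -/

open HopfTwist HopfTwist.Twist TensorProduct in
theorem theorem5p3 {k : Type*} [Field k] [IsAlgClosed k] [CharZero k]
    {G G' : Type*} [Group G] [Finite G] [Group G'] [Finite G']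
    (H : Subgroup G) (H' : Subgroup G')
    (J : HopfTwist.Twist k (MonoidAlgebra k H)) (J' : HopfTwist.Twist k (MonoidAlgebra k H'))
    (hJ : J.IsMinimal) (hJ' : J'.IsMinimal)
    (h : HopfTwist.TriangularIso
      (J.map (MonoidAlgebra.mapDomainBialgHom k H.subtype)).rMatrix
      (J'.map (MonoidAlgebra.mapDomainBialgHom k H'.subtype)).rMatrix) :
    ∃ (φ : G ≃* G') (hφ : H.map (φ : G →* G') = H'),
      HopfTwist.Twist.GaugeEquivalent
        (J.map (MonoidAlgebra.mapDomainBialgHom k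
          ((φ.subgroupMap H).trans (MulEquiv.subgroupCongr hφ) : H →* H')))
        J' := by
  obtain ⟨f, hf, hfε, hfR⟩ := exists_algEquiv_of_triangularIso h
  have hι' := mapDomain_subtype_injective (k := k) H'
  obtain ⟨g, hg, hgs, hgc, hgε, hgR⟩ := exists_restrict hJ hJ' (mapDomain_subtype_injective H)
    hι' hf hfε hfR
  have : FiniteDimensional k (MonoidAlgebra k H') :=
    Module.Finite.equiv (MonoidAlgebra.coeffLinearEquiv k).symm
  -- Working with the restriction g puts x in k[H'], which solving the equation for f in k[G'] would
  -- not ensure.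
  obtain ⟨x, hx, hxJ⟩ := exists_conj hgc hgε hgR
  set ι := MonoidAlgebra.mapDomainBialgHom k H.subtype with hιdef
  set ι' := MonoidAlgebra.mapDomainBialgHom k H'.subtype with hι'def
  let X : (MonoidAlgebra k G')ˣ := Units.map (ι' : MonoidAlgebra k H' →* MonoidAlgebra k G') x
  have hX : (X : MonoidAlgebra k G') = ι' x := rfl
  have hXi : ((X⁻¹ : (MonoidAlgebra k G')ˣ) : MonoidAlgebra k G') =
    ι' (x⁻¹ : (MonoidAlgebra k H')ˣ) := rfl
  have hXJ : Coalgebra.comul (R := k) (X : MonoidAlgebra k G') * (J'.map ι').elt =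
      ((X : MonoidAlgebra k G') ⊗ₜ[k] (X : MonoidAlgebra k G')) *
        tmap (f : MonoidAlgebra k G →ₐ[k] MonoidAlgebra k G') (J.map ι).elt := by
    -- The equation for f in k[G'] is the image under ι' ⊗ ι' of the equation for g, since ι' g = f
    -- ι.
    have h1 := congrArg (tmap (ι' : MonoidAlgebra k H' →ₐ[k] MonoidAlgebra k G')) hxJ
    rw [map_mul, map_mul, tmap_comul, ← tmap_comp] at h1
    have h2 : (ι' : MonoidAlgebra k H' →ₐ[k] MonoidAlgebra k G').comp g =
      (f : MonoidAlgebra k G →ₐ[k] MonoidAlgebra k G').comp ι := AlgHom.ext hg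
    rw [h2, tmap_comp] at h1
    exact h1
  obtain ⟨F, hF⟩ := exists_bialgEquiv_conj hf hfε hXJ
  obtain ⟨φ, hφ⟩ := exists_mulEquiv_of_bialgEquiv F
  have hFι (a : MonoidAlgebra k H) :
      F (ι a) = ι' (x * g a * (x⁻¹ : (MonoidAlgebra k H')ˣ)) := by
    rw [hF, ← hg, map_mul, map_mul, hX, hXi]
  have hH : H.map (φ : G →* G') = H' := by
    apply le_antisymm
    · rintro _ ⟨a, ha, rfl⟩
      refine mem_of_mapDomain_subtype_eq_single (k := k)
        (y := (x : MonoidAlgebra k H') * g (MonoidAlgebra.single ⟨a, ha⟩ 1) *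
          ((x⁻¹ : (MonoidAlgebra k H')ˣ) : MonoidAlgebra k H')) ?_
      rw [← hι'def, ← hFι, hιdef, MonoidAlgebra.mapDomainBialgHom_single]
      exact hφ a
    · intro b hb
      -- The preimage under g of x⁻¹ b x is chosen because conjugation by x then gives F(ι y) = b,
      -- so that ι y is the group element φ⁻¹(b).
      obtain ⟨y, hy⟩ := hgs (((x⁻¹ : (MonoidAlgebra k H')ˣ) : MonoidAlgebra k H') *
        MonoidAlgebra.single (⟨b, hb⟩ : H') (1 : k) * x)
      refine ⟨φ.symm b, ?_, φ.apply_symm_apply b⟩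
      refine mem_of_mapDomain_subtype_eq_single (k := k) (y := y) (F.injective ?_)
      change F (ι y) = F (MonoidAlgebra.single (φ.symm b) 1)
      rw [hFι, hy, hφ, φ.apply_symm_apply, mul_assoc, mul_assoc, Units.mul_inv,
        mul_one, Units.mul_inv_cancel_left, hι'def, MonoidAlgebra.mapDomainBialgHom_single]
      rfl
  refine ⟨φ, hH, ?_⟩
  set ψ := MonoidAlgebra.mapDomainBialgHom k
    ((φ.subgroupMap H).trans (MulEquiv.subgroupCongr hH) : H →* H') with hψdef
  have hψ (a : MonoidAlgebra k H) :
      (ψ : MonoidAlgebra k H →ₐ[k] MonoidAlgebra k H') a =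
        x * g a * (x⁻¹ : (MonoidAlgebra k H')ˣ) := by
    -- Inside k[G'] both sides are the restriction of F to k[H], which it suffices to compare on
    -- group elements.
    apply hι'
    rw [← hFι]
    have : ((ι'.comp ψ : MonoidAlgebra k H →ₐc[k] MonoidAlgebra k G') :
        MonoidAlgebra k H →ₐ[k] MonoidAlgebra k G') =
        (((F : MonoidAlgebra k G →ₐc[k] MonoidAlgebra k G').comp ι :
          MonoidAlgebra k H →ₐc[k] MonoidAlgebra k G') :
        MonoidAlgebra k H →ₐ[k] MonoidAlgebra k G') := by
      refine MonoidAlgebra.algHom_ext (fun a => ?_) (by ext)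
      change ι' (ψ (MonoidAlgebra.single a 1)) = F (ι (MonoidAlgebra.single a 1))
      rw [hψdef, hιdef, hι'def, MonoidAlgebra.mapDomainBialgHom_single,
        MonoidAlgebra.mapDomainBialgHom_single, MonoidAlgebra.mapDomainBialgHom_single, hφ]
      rfl
    exact AlgHom.congr_fun this a
  have hψJ : ((J.map ψ).elt : MonoidAlgebra k H' ⊗[k] MonoidAlgebra k H') =
      Coalgebra.comul (R := k) (x : MonoidAlgebra k H') * J'.elt *
        (((x⁻¹ : (MonoidAlgebra k H')ˣ) : MonoidAlgebra k H') ⊗ₜ[k]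
          ((x⁻¹ : (MonoidAlgebra k H')ˣ) : MonoidAlgebra k H')) := by
    rw [map_elt, tmap_conj g _ x hψ, hxJ]
  -- The identity `hψJ` expresses (φ ⊗ φ)(J) as the gauge transform of J' by x; the required
  -- direction uses the inverse.
  refine ⟨x⁻¹, ?_, ?_⟩
  · have h1 : Bialgebra.counitAlgHom k (MonoidAlgebra k H')
        (x * (x⁻¹ : (MonoidAlgebra k H')ˣ)) = 1 := by rw [Units.mul_inv, map_one]
    rw [map_mul] at h1
    rwa [Bialgebra.counitAlgHom_apply, hx, one_mul] at h1
  · rw [hψJ, inv_inv, ← mul_assoc, ← mul_assoc, mul_assoc _ _ ((x : MonoidAlgebra k H') ⊗ₜ[k] _),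
      tmul_inv_mul_tmul, mul_one, ← Bialgebra.comul_mul, Units.inv_mul, Bialgebra.comul_one,
      one_mul]
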